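/- Let $K$ be a field of any characteristic; all vector spaces and tensor products are over $K$. A $\mathcal P_\nearrow$-algebra is a vector space $A$ with two bilinear products $m(x,y)=xy$ and $\nearrow$ such that $(x\nearrow y)z=x\nearrow(yz)$, $(xy)z=x(yz)$ and $(x\nearrow y)\nearrow z=x\nearrow(y\nearrow z)$ for all $x,y,z$. A double $\mathcal P_\nearrow$-infinitesimal bialgebra is a $\mathcal P_\nearrow$-algebra $A$ with two linear maps $\tilde\Delta,\tilde\Delta_\nearrow:A\to A\otimes A$ such that $$(\tilde\Delta\otimes Id)\tilde\Delta=(Id\otimes\tilde\Delta)\tilde\Delta,\quad(\tilde\Delta_\nearrow\otimes Id)\tilde\Delta_\nearrow=(Id\otimes\tilde\Delta_\nearrow)\tilde\Delta_\nearrow,\quad(\tilde\Delta\otimes Id)\tilde\Delta_\nearrow=(Id\otimes\tilde\Delta_\nearrow)\tilde\Delta\qquad(*)$$ and, writing $\tilde\Delta(x)=x'\otimes x''$ and $\tilde\Delta_\nearrow(x)=x'_\nearrow\otimes x''_\nearrow$, for all $x,y\in A$: $$\tilde\Delta(xy)=xy'\otimes y''+x'\otimes x''y+x\otimes y,\qquad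 \tilde\Delta(x\nearrow y)=x\nearrow y'\otimes y''+x'\otimes x''\nearrow y+x\otimes y,$$ $$\tilde\Delta_\nearrow(xy)=xy'_\nearrow\otimes y''_\nearrow+x'_\nearrow\otimes x''_\nearrow y+x\otimes y,\qquad \tilde\Delta_\nearrow(x\nearrow y)=x\nearrow y'_\nearrow\otimes y''_\nearrow .$$ Put $Prim(A)=Ker(\tilde\Delta)\cap Ker(\tilde\Delta_\nearrow)$. An iterated coproduct $A\to A^{\otimes(n+1)}$ is any composite of $n$ coproducts, each $\tilde\Delta$ or $\tilde\Delta_\nearrow$ and each applied to one tensor factor. Here $A$ (or any vector space with two coproducts satisfying $(*)$; call this a coalgebra) is connected if for every $a$ there is $N$ such that for all $n\ge N$ all iterated coproducts to $A^{\otimes(n+1)}$ vanish on $a$. Let $F(V)$ be the free $\mathcal P_\nearrow$-algebra generated by a vector space $V$. Theorem 45 (rigidity theorem). Every connected double $\mathcal P_\nearrow$-infinitesimal bialgebra $A$ is isomorphic, as a double $\mathcal P_\nearrow$-infinitesimal bialgebra, to $F(Prim(A))$, where the latter carries coproducts that make it a double $\mathcal P_\nearrow$-infinitesimal bialgebra and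 vanish on $Prim(A)$; the isomorphism may be chosen to be the identity on $Prim(A)$. Moreover, $((\mathcal P_\nearrow)^{op},\mathcal P_\nearrow,\mathbb{VECT})$ is a good triple of operads, in the following sense. (1) For every vector space $V$ there is exactly one pair of coproducts on $F(V)$ that makes it a double $\mathcal P_\nearrow$-infinitesimal bialgebra and vanishes on the generators; with it $F(V)$ is connected, $V\to F(V)$ is injective and $Prim(F(V))$ is its image $V$. (2) For every double $\mathcal P_\nearrow$-infinitesimal bialgebra $A$ the following are equivalent: (a) $A$ is connected; (b) $A$ is isomorphic to $F(Prim(A))$ as a double $\mathcal P_\nearrow$-infinitesimal bialgebra, by an isomorphism that is the identity on $Prim(A)$; (c) $A$ is connected and cofree over $Prim(A)$ among connected coalgebras: there is a linear map $\pi:A\to Prim(A)$ that is the identity on $Prim(A)$ such that for every connected coalgebra $C$, every linear map $f:C\to Prim(A)$ is $\pi\circ g$ for a unique linear map $g:C\to A$ that commutes with both coproducts. -/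

import Mathlib

open scoped TensorProduct

universe u v w

noncomputable section

/-! ### `P_↗`-algebras and the free `P_↗`-algebra

Throughout, `m` is the product `x y` and `ne` is the product `x ↗ y`. -/

/-- `(A, m, ↗)` is a (non unitary) `P_↗`-algebra. -/
structure IsNEAlgebra {K : Type u} [Field K] {A : Type v} [AddCommGroup A] [Module K A]
    (m ne : A →ₗ[K] A →ₗ[K] A) : Prop where
  ne_m : ∀ x y z : A, m (ne x y) z = ne x (m y z)
  m_assoc : ∀ x y z : A, m (m x y) z = m x (m y z)
  ne_assoc : ∀ x y z : A, ne (ne x y) z = ne x (ne y z)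

/-- Non-associative words in the elements of `V`, with two formal binary operations
(planar binary trees with vertices decorated by `m` or `↗` and leaves decorated by `V`). -/
inductive NEWord (V : Type v) : Type v
  | of : V → NEWord V
  | m : NEWord V → NEWord V → NEWord V
  | ne : NEWord V → NEWord V → NEWord V

namespace FreeNE

variable (K : Type u) [Field K] (V : Type v) [AddCommGroup V] [Module K V]

/-- The vector space with basis the non-associative words. -/
abbrev Pre : Type (max u v) := NEWord V →₀ K

/-- The bilinear extension of the formal operation `m`. -/
def preM : Pre K V →ₗ[K] Pre K V →ₗ[K] Pre K V :=
  Finsupp.linearCombination K fun u => Finsupp.lmapDomain K K (NEWord.m u)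

/-- The bilinear extension of the formal operation `↗`. -/
def preNE : Pre K V →ₗ[K] Pre K V →ₗ[K] Pre K V :=
  Finsupp.linearCombination K fun u => Finsupp.lmapDomain K K (NEWord.ne u)

/-- A word of length one. -/
def preOf (x : V) : Pre K V := Finsupp.single (NEWord.of x) 1

/-- `I` is a two-sided ideal for both operations, such that modulo `I` the letters depend
linearly on `V` and the three relations of `P_↗` hold. -/
structure IsRelIdeal (I : Submodule K (Pre K V)) : Prop where
  of_add : ∀ x y : V, preOf K V (x + y) - (preOf K V x + preOf K V y) ∈ I
  of_smul : ∀ (c : K) (x : V), preOf K V (c • x) - c • preOf K V x ∈ I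
  ne_m : ∀ x y z, preM K V (preNE K V x y) z - preNE K V x (preM K V y z) ∈ I
  m_assoc : ∀ x y z, preM K V (preM K V x y) z - preM K V x (preM K V y z) ∈ I
  ne_assoc : ∀ x y z, preNE K V (preNE K V x y) z - preNE K V x (preNE K V y z) ∈ I
  m_left : ∀ x y, y ∈ I → preM K V x y ∈ I
  m_right : ∀ x y, x ∈ I → preM K V x y ∈ I
  ne_left : ∀ x y, y ∈ I → preNE K V x y ∈ I
  ne_right : ∀ x y, x ∈ I → preNE K V x y ∈ I

/-- The ideal generated by the relations. -/
def relIdeal : Submodule K (Pre K V) := sInf {I | IsRelIdeal K V I}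

theorem relIdeal_isRelIdeal : IsRelIdeal K V (relIdeal K V) where
  of_add x y := Submodule.mem_sInf.2 fun _ h => h.of_add x y
  of_smul c x := Submodule.mem_sInf.2 fun _ h => h.of_smul c x
  ne_m x y z := Submodule.mem_sInf.2 fun _ h => h.ne_m x y z
  m_assoc x y z := Submodule.mem_sInf.2 fun _ h => h.m_assoc x y z
  ne_assoc x y z := Submodule.mem_sInf.2 fun _ h => h.ne_assoc x y z
  m_left x y hy := Submodule.mem_sInf.2 fun I h => h.m_left x y (Submodule.mem_sInf.1 hy I h)
  m_right x y hx := Submodule.mem_sInf.2 fun I h => h.m_right x y (Submodule.mem_sInf.1 hx I h)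
  ne_left x y hy := Submodule.mem_sInf.2 fun I h => h.ne_left x y (Submodule.mem_sInf.1 hy I h)
  ne_right x y hx := Submodule.mem_sInf.2 fun I h => h.ne_right x y (Submodule.mem_sInf.1 hx I h)

end FreeNE

/-- The free `P_↗`-algebra generated by the vector space `V`. -/
def FreeNE (K : Type u) [Field K] (V : Type v) [AddCommGroup V] [Module K V] :
    Type (max u v) :=
  FreeNE.Pre K V ⧸ FreeNE.relIdeal K V

namespace FreeNE

variable (K : Type u) [Field K] (V : Type v) [AddCommGroup V] [Module K V]

instance : AddCommGroup (FreeNE K V) :=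
  inferInstanceAs (AddCommGroup (Pre K V ⧸ relIdeal K V))

instance : Module K (FreeNE K V) :=
  inferInstanceAs (Module K (Pre K V ⧸ relIdeal K V))

/-- The class of a combination of words in the free `P_↗`-algebra. -/
def mk : Pre K V →ₗ[K] FreeNE K V := (relIdeal K V).mkQ

/-- The product `m` of the free `P_↗`-algebra. -/
def m : FreeNE K V →ₗ[K] FreeNE K V →ₗ[K] FreeNE K V :=
  (relIdeal K V).liftQ
    { toFun := fun x => (relIdeal K V).liftQ (mk K V ∘ₗ preM K V x) fun y hy =>
        (Submodule.Quotient.mk_eq_zero _).2 ((relIdeal_isRelIdeal K V).m_left x y hy)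
      map_add' := fun x y => Submodule.linearMap_qext _ (LinearMap.ext fun z => by
        change mk K V (preM K V (x + y) z) = mk K V (preM K V x z) + mk K V (preM K V y z)
        rw [map_add, LinearMap.add_apply, map_add])
      map_smul' := fun c x => Submodule.linearMap_qext _ (LinearMap.ext fun z => by
        change mk K V (preM K V (c • x) z) = c • mk K V (preM K V x z)
        rw [map_smul, LinearMap.smul_apply, map_smul]) }
    fun x hx => Submodule.linearMap_qext _ (LinearMap.ext fun z =>
      (Submodule.Quotient.mk_eq_zero _).2 ((relIdeal_isRelIdeal K V).m_right x z hx))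

/-- The product `↗` of the free `P_↗`-algebra. -/
def ne : FreeNE K V →ₗ[K] FreeNE K V →ₗ[K] FreeNE K V :=
  (relIdeal K V).liftQ
    { toFun := fun x => (relIdeal K V).liftQ (mk K V ∘ₗ preNE K V x) fun y hy =>
        (Submodule.Quotient.mk_eq_zero _).2 ((relIdeal_isRelIdeal K V).ne_left x y hy)
      map_add' := fun x y => Submodule.linearMap_qext _ (LinearMap.ext fun z => by
        change mk K V (preNE K V (x + y) z) = mk K V (preNE K V x z) + mk K V (preNE K V y z)
        rw [map_add, LinearMap.add_apply, map_add])
      map_smul' := fun c x => Submodule.linearMap_qext _ (LinearMap.ext fun z => by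
        change mk K V (preNE K V (c • x) z) = c • mk K V (preNE K V x z)
        rw [map_smul, LinearMap.smul_apply, map_smul]) }
    fun x hx => Submodule.linearMap_qext _ (LinearMap.ext fun z =>
      (Submodule.Quotient.mk_eq_zero _).2 ((relIdeal_isRelIdeal K V).ne_right x z hx))

/-- The canonical linear map from `V` to the free `P_↗`-algebra generated by `V`. -/
def ι : V →ₗ[K] FreeNE K V where
  toFun x := mk K V (preOf K V x)
  map_add' x y := by
    rw [← map_add]
    exact (Submodule.Quotient.eq _).2 ((relIdeal_isRelIdeal K V).of_add x y)
  map_smul' c x := by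
    rw [RingHom.id_apply, ← map_smul]
    exact (Submodule.Quotient.eq _).2 ((relIdeal_isRelIdeal K V).of_smul c x)

end FreeNE

/-! ### Coalgebras and double `P_↗`-infinitesimal bialgebras

Here `Δ` is the coproduct `Δ̃` and `Δne` is the coproduct `Δ̃_↗`. -/

/-- The three relations between `Δ` and `Δne`: both are coassociative and
`(Δ ⊗ Id) ∘ Δne = (Id ⊗ Δne) ∘ Δ`; that is, `(A, Δ, Δne)` is a coalgebra over `(P_↗)^op`. -/
structure IsOpNECoalgebra {K : Type u} [Field K] {A : Type v} [AddCommGroup A] [Module K A]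
    (Δ Δne : A →ₗ[K] A ⊗[K] A) : Prop where
  coassoc : ∀ x : A,
    TensorProduct.assoc K A A A (Δ.rTensor A (Δ x)) = Δ.lTensor A (Δ x)
  coassoc_ne : ∀ x : A,
    TensorProduct.assoc K A A A (Δne.rTensor A (Δne x)) = Δne.lTensor A (Δne x)
  mixed : ∀ x : A,
    TensorProduct.assoc K A A A (Δ.rTensor A (Δne x)) = Δne.lTensor A (Δ x)

/-- `(A, m, ↗, Δ, Δne)` is a double `P_↗`-infinitesimal bialgebra. -/
structure IsDoubleBialgebra {K : Type u} [Field K] {A : Type v} [AddCommGroup A] [Module K A]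
    (m ne : A →ₗ[K] A →ₗ[K] A) (Δ Δne : A →ₗ[K] A ⊗[K] A) : Prop where
  alg : IsNEAlgebra m ne
  coalg : IsOpNECoalgebra Δ Δne
  comul_m : ∀ x y : A,
    Δ (m x y) = (m x).rTensor A (Δ y) + (m.flip y).lTensor A (Δ x) + x ⊗ₜ[K] y
  comul_ne : ∀ x y : A,
    Δ (ne x y) = (ne x).rTensor A (Δ y) + (ne.flip y).lTensor A (Δ x) + x ⊗ₜ[K] y
  comulNE_m : ∀ x y : A,
    Δne (m x y) = (m x).rTensor A (Δne y) + (m.flip y).lTensor A (Δne x) + x ⊗ₜ[K] y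
  comulNE_ne : ∀ x y : A,
    Δne (ne x y) = (ne x).rTensor A (Δne y)

/-- The space of primitive elements `Ker Δ ∩ Ker Δne`. -/
def primitives {K : Type u} [Field K] {A : Type v} [AddCommGroup A] [Module K A]
    (Δ Δne : A →ₗ[K] A ⊗[K] A) : Submodule K A :=
  LinearMap.ker Δ ⊓ LinearMap.ker Δne

/-- The shapes of the iterated coproducts: planar binary trees whose internal vertices are
decorated by one of the two coproducts. -/
inductive CoShape : Type
  | leaf : CoShape
  | node : CoShape → CoShape → CoShape
  | nodeNE : CoShape → CoShape → CoShape

/-- The number of leaves, i.e. the number of tensor factors in the target. -/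
def CoShape.leaves : CoShape → ℕ
  | .leaf => 1
  | .node l r => l.leaves + r.leaves
  | .nodeNE l r => l.leaves + r.leaves

/-- The iterated coproduct of shape `t`: the identity for a leaf, `(f_l ⊗ f_r) ∘ Δ` for a root
decorated by `Δ` with subtrees `l, r`, and `(f_l ⊗ f_r) ∘ Δne` for a root decorated by `Δne`. Its
target `A^{⊗ n}`, `n = t.leaves`, is seen as the `n`-th homogeneous component of the tensor
algebra of the vector space `A`, in which `⊗` is the multiplication. -/
def iteratedCoproduct {K : Type u} [Field K] {A : Type v} [AddCommGroup A] [Module K A]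
    (Δ Δne : A →ₗ[K] A ⊗[K] A) : CoShape → (A →ₗ[K] TensorAlgebra K A)
  | .leaf => TensorAlgebra.ι K
  | .node l r => LinearMap.mul' K (TensorAlgebra K A) ∘ₗ
      TensorProduct.map (iteratedCoproduct Δ Δne l) (iteratedCoproduct Δ Δne r) ∘ₗ Δ
  | .nodeNE l r => LinearMap.mul' K (TensorAlgebra K A) ∘ₗ
      TensorProduct.map (iteratedCoproduct Δ Δne l) (iteratedCoproduct Δ Δne r) ∘ₗ Δne

/-- Connectedness: for any `a`, every iterated coproduct `A → A^{⊗ (n+1)}` vanishes on `a` for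
`n` great enough. -/
def IsConnectedCoalgebra {K : Type u} [Field K] {A : Type v} [AddCommGroup A] [Module K A]
    (Δ Δne : A →ₗ[K] A ⊗[K] A) : Prop :=
  ∀ a : A, ∃ N : ℕ, ∀ n : ℕ, N ≤ n → ∀ t : CoShape, t.leaves = n + 1 →
    iteratedCoproduct Δ Δne t a = 0

/-- The linear map `f` commutes with both coproducts. -/
structure IsCoalgebraHom {K : Type u} [Field K] {C : Type w} [AddCommGroup C] [Module K C]
    {A : Type v} [AddCommGroup A] [Module K A]
    (δ δne : C →ₗ[K] C ⊗[K] C) (Δ Δne : A →ₗ[K] A ⊗[K] A) (f : C →ₗ[K] A) : Prop where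
  comul : ∀ x : C, Δ (f x) = TensorProduct.map f f (δ x)
  comulNE : ∀ x : C, Δne (f x) = TensorProduct.map f f (δne x)

/-- The linear map `f` commutes with both products. -/
structure IsNEAlgebraHom {K : Type u} [Field K] {B : Type w} [AddCommGroup B] [Module K B]
    {A : Type v} [AddCommGroup A] [Module K A]
    (m' ne' : B →ₗ[K] B →ₗ[K] B) (m ne : A →ₗ[K] A →ₗ[K] A) (f : B →ₗ[K] A) : Prop where
  map_m : ∀ x y : B, f (m' x y) = m (f x) (f y)
  map_ne : ∀ x y : B, f (ne' x y) = ne (f x) (f y)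

/-- `δ, δne` are the coproducts of the free `P_↗`-algebra generated by `V`, as a double
`P_↗`-infinitesimal bialgebra: the compatibilities hold and all elements of `V` are primitive. -/
def IsFreeDoubleStructure (K : Type u) [Field K] (V : Type v) [AddCommGroup V] [Module K V]
    (δ δne : FreeNE K V →ₗ[K] FreeNE K V ⊗[K] FreeNE K V) : Prop :=
  IsDoubleBialgebra (FreeNE.m K V) (FreeNE.ne K V) δ δne ∧
    ∀ x : V, δ (FreeNE.ι K V x) = 0 ∧ δne (FreeNE.ι K V x) = 0

/-- `A` is isomorphic, as a double `P_↗`-infinitesimal bialgebra, to the free `P_↗`-algebra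
generated by its primitive elements, by an isomorphism which is the identity on these elements. -/
def IsFreeOnPrimitives {K : Type u} [Field K] {A : Type v} [AddCommGroup A] [Module K A]
    (m ne : A →ₗ[K] A →ₗ[K] A) (Δ Δne : A →ₗ[K] A ⊗[K] A) : Prop :=
  ∃ δ δne : FreeNE K (primitives Δ Δne) →ₗ[K]
      FreeNE K (primitives Δ Δne) ⊗[K] FreeNE K (primitives Δ Δne),
    IsFreeDoubleStructure K (primitives Δ Δne) δ δne ∧
    ∃ e : FreeNE K (primitives Δ Δne) ≃ₗ[K] A,
      IsNEAlgebraHom (FreeNE.m K (primitives Δ Δne)) (FreeNE.ne K (primitives Δ Δne)) m ne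
        e.toLinearMap ∧
      IsCoalgebraHom δ δne Δ Δne e.toLinearMap ∧
      ∀ x : primitives Δ Δne, e (FreeNE.ι K (primitives Δ Δne) x) = (x : A)

/-- `(A, Δ, Δne)` is connected and is cofree, among connected coalgebras, over its
primitive elements. -/
def IsCofreeOnPrimitives {K : Type u} [Field K] {A : Type v} [AddCommGroup A] [Module K A]
    (Δ Δne : A →ₗ[K] A ⊗[K] A) : Prop :=
  IsConnectedCoalgebra Δ Δne ∧
  ∃ π : A →ₗ[K] primitives Δ Δne, (∀ x : primitives Δ Δne, π (x : A) = x) ∧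
    ∀ (C : Type w) [AddCommGroup C] [Module K C] (δ δne : C →ₗ[K] C ⊗[K] C),
      IsOpNECoalgebra δ δne → IsConnectedCoalgebra δ δne →
      ∀ f : C →ₗ[K] primitives Δ Δne,
        ∃! g : C →ₗ[K] A, IsCoalgebraHom δ δne Δ Δne g ∧ π ∘ₗ g = f

end

/-!
A connected double bialgebra `A` is analysed through its two nested infinitesimal structures.

* For `↗` and `Δ` it is an infinitesimal bialgebra, and there is a projection `e` onto `Ker Δ`
  along `A ↗ A`, given by the recursion `e(x) = x - e(x') ↗ x''`
  (`IsDoubleBialgebra.exists_kerProjection`). The mixed relation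
  `(Δ ⊗ Id) Δne = (Id ⊗ Δne) Δ` makes `e` a morphism of right comodules for `Δne`, and the relation
  `(x ↗ y) z = x ↗ (y z)` makes it a morphism of right `m`-modules, for the action
  `x ◁ y = e(x y)` on `Ker Δ`.
* `Ker Δ` is thus a Hopf module for `m` and `Δne`, and a second recursion
  `π(x) = e(x) - e(π(x') x'')`, now with `Δne`, gives a projection `π` onto the primitive elements
  which kills both products (`IsKerProjection.exists_primProjection`).

Going backwards through the two recursions, a linear map `f` from a connected coalgebra to the
primitive elements lifts to the coalgebra morphism `g(x) = p(x) + p(x') ↗ g(x'')`, where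
`p(x) = f(x) + e(f(x') g(x''))`, the first formula being written with `Δ` and the second one with
`Δne` (`IsPrimProjection.exists_lift`). A coalgebra morphism `g` is determined by `π g`
(`IsPrimProjection.hom_ext`). So every connected double bialgebra is cofree over its primitive
elements. All these recursions run along the coradical filtration.

The free algebra carries a unique double structure, is connected because its coproducts preserve
the number of letters, and its primitive elements are the generators because `π` kills all
products. If `A` is connected, the algebra morphism from the free algebra on its primitive elements
to `A` and the coalgebra morphism in the other direction given by cofreeness are inverse to each
other, since both composites are coalgebra morphisms compatible with the projections
(`IsDoubleBialgebra.isFreeOnPrimitives`). No normal form for the elements of the free algebra is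
needed.
-/

/-! ### Contractions and the coradical filtration -/

namespace TensorAlgebra

variable {K : Type u} [Field K] {C : Type v} [AddCommGroup C] [Module K C]

/-- Contraction of the first letter of a tensor with a linear form. -/
theorem exists_contractLeft (l : C →ₗ[K] K) :
    ∃ D : TensorAlgebra K C →ₗ[K] TensorAlgebra K C, ∀ c t, D (ι K c * t) = l c • t := by
  let T := TensorAlgebra K C
  -- `c` acts on pairs by `(x, y) ↦ (c x, l(c) x)`, so that `t` sends `(1, 0)` to `(t, D t)`.
  let a : C →ₗ[K] Module.End K (T × T) := LinearMap.mk₂ K (fun c p => (ι K c * p.1, l c • p.1))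
    (by intros; ext1 <;> simp [add_mul, add_smul])
    (by intros; ext1 <;> simp [mul_smul])
    (by intros; ext1 <;> simp [mul_add])
    (by intro r c p; ext1 <;> simp [smul_comm r])
  have fst : ∀ t : T, (lift K a t (1, 0)).1 = t := by
    have key : ∀ (t : T) (p : T × T), (lift K a t p).1 = t * p.1 := by
      intro t
      induction t using TensorAlgebra.induction with
      | algebraMap r => intro p; simp [Algebra.algebraMap_eq_smul_one]
      | ι c => intro p; simp [a]
      | mul x y hx hy => intro p; simp [hx, hy, mul_assoc]
      | add x y hx hy => intro p; simp [hx, hy, add_mul]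
    intro t; simp [key]
  refine ⟨LinearMap.snd K T T ∘ₗ LinearMap.applyₗ (1, 0) ∘ₗ (lift K a).toLinearMap, fun c t => ?_⟩
  have : (lift K a (ι K c * t)) (1, 0) = a c (lift K a t (1, 0)) := by simp
  simp only [LinearMap.comp_apply, LinearMap.applyₗ_apply_apply, AlgHom.toLinearMap_apply, this]
  simp [a, fst]

/-- Contraction of the last letter of a tensor with a linear form. -/
theorem exists_contractRight (l : C →ₗ[K] K) :
    ∃ D : TensorAlgebra K C →ₗ[K] TensorAlgebra K C, ∀ t c, D (t * ι K c) = l c • t := by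
  let T := TensorAlgebra K C
  let a : C →ₗ[K] Module.End K (T × T) := LinearMap.mk₂ K (fun c p => (p.1 * ι K c, l c • p.1))
    (by intros; ext1 <;> simp [mul_add, add_smul])
    (by intros; ext1 <;> simp [mul_smul])
    (by intros; ext1 <;> simp [add_mul])
    (by intro r c p; ext1 <;> simp [smul_comm r])
  let b : C →ₗ[K] (Module.End K (T × T))ᵐᵒᵖ := (MulOpposite.opLinearEquiv K).toLinearMap ∘ₗ a
  have fst : ∀ t : T, ((lift K b t).unop (1, 0)).1 = t := by
    have key : ∀ (t : T) (p : T × T), ((lift K b t).unop p).1 = p.1 * t := by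
      intro t
      induction t using TensorAlgebra.induction with
      | algebraMap r => intro p; simp [Algebra.algebraMap_eq_smul_one]
      | ι c => intro p; simp [a, b]
      | mul x y hx hy => intro p; simp [hx, hy, mul_assoc]
      | add x y hx hy => intro p; simp [hx, hy, mul_add]
    intro t; simp [key]
  refine ⟨LinearMap.snd K T T ∘ₗ LinearMap.applyₗ (1, 0) ∘ₗ
    (MulOpposite.opLinearEquiv K).symm.toLinearMap ∘ₗ (lift K b).toLinearMap, fun t c => ?_⟩
  have : (lift K b (t * ι K c)).unop (1, 0) = a c ((lift K b t).unop (1, 0)) := by simp [b]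
  simp only [LinearMap.comp_apply, LinearMap.applyₗ_apply_apply, AlgHom.toLinearMap_apply,
    LinearEquiv.coe_coe, MulOpposite.coe_opLinearEquiv_symm, this]
  simp [a, fst]

end TensorAlgebra

section Filtration

variable {K : Type u} [Field K] {C : Type v} [AddCommGroup C] [Module K C]

theorem TensorProduct.eq_zero_of_forall_contractLeft {M : Type w} [AddCommGroup M] [Module K M]
    (t : C ⊗[K] M) (h : ∀ l : C →ₗ[K] K, TensorProduct.lid K M (l.rTensor M t) = 0) : t = 0 := by
  classical
  let b := Module.Basis.ofVectorSpace K C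
  apply (TensorProduct.equivFinsuppOfBasisLeft (N := M) b).injective
  ext i
  rw [TensorProduct.equivFinsuppOfBasisLeft_apply, map_zero, h]
  rfl

theorem TensorProduct.eq_zero_of_forall_contractRight {M : Type w} [AddCommGroup M] [Module K M]
    (t : M ⊗[K] C) (h : ∀ l : C →ₗ[K] K, TensorProduct.rid K M (l.lTensor M t) = 0) : t = 0 := by
  classical
  let b := Module.Basis.ofVectorSpace K C
  apply (TensorProduct.equivFinsuppOfBasisRight (M := M) b).injective
  ext i
  rw [TensorProduct.equivFinsuppOfBasisRight_apply, map_zero, h]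
  rfl

/-- The image of `S ⊗ S` in `C ⊗ C`. -/
def Submodule.tensorSquare (S : Submodule K C) : Submodule K (C ⊗[K] C) :=
  LinearMap.range (TensorProduct.map S.subtype S.subtype)

theorem Submodule.eq_of_mem_tensorSquare {S : Submodule K C} {X : Type*} [AddCommGroup X]
    [Module K X] {f g : C ⊗[K] C →ₗ[K] X} (h : ∀ x ∈ S, ∀ y ∈ S, f (x ⊗ₜ y) = g (x ⊗ₜ y))
    {t : C ⊗[K] C} (ht : t ∈ S.tensorSquare) : f t = g t := by
  obtain ⟨s, rfl⟩ := ht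
  have : f ∘ₗ TensorProduct.map S.subtype S.subtype = g ∘ₗ TensorProduct.map S.subtype S.subtype :=
    TensorProduct.ext' fun x y => h x x.2 y y.2
  exact LinearMap.congr_fun this s

/-- A tensor of which all contractions, on either side, lie in `S` belongs to `S ⊗ S`. -/
theorem Submodule.mem_tensorSquare_of_contract (S : Submodule K C) (t : C ⊗[K] C)
    (hl : ∀ l : C →ₗ[K] K, TensorProduct.lid K C (l.rTensor C t) ∈ S)
    (hr : ∀ l : C →ₗ[K] K, TensorProduct.rid K C (l.lTensor C t) ∈ S) :
    t ∈ S.tensorSquare := by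
  obtain ⟨r, hrS⟩ := LinearMap.exists_leftInverse_of_injective S.subtype S.ker_subtype
  let q : C →ₗ[K] C := S.subtype ∘ₗ r
  have hq : ∀ x ∈ S, q x = x := fun x hx =>
    congrArg Subtype.val (LinearMap.congr_fun hrS ⟨x, hx⟩)
  have h1 : q.lTensor C t = t := by
    refine sub_eq_zero.1 (TensorProduct.eq_zero_of_forall_contractLeft _ fun l => ?_)
    have : ∀ s : C ⊗[K] C, TensorProduct.lid K C (l.rTensor C (q.lTensor C s)) =
        q (TensorProduct.lid K C (l.rTensor C s)) := fun s => by
      induction s with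
      | zero => simp
      | tmul x y => simp
      | add x y hx hy => simp only [map_add, hx, hy]
    rw [map_sub, map_sub, this, hq _ (hl l), sub_self]
  have h2 : q.rTensor C t = t := by
    refine sub_eq_zero.1 (TensorProduct.eq_zero_of_forall_contractRight _ fun l => ?_)
    have : ∀ s : C ⊗[K] C, TensorProduct.rid K C (l.lTensor C (q.rTensor C s)) =
        q (TensorProduct.rid K C (l.lTensor C s)) := fun s => by
      induction s with
      | zero => simp
      | tmul x y => simp
      | add x y hx hy => simp only [map_add, hx, hy]
    rw [map_sub, map_sub, this, hq _ (hr l), sub_self]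
  refine ⟨TensorProduct.map r r t, ?_⟩
  rw [← LinearMap.comp_apply, ← TensorProduct.map_comp]
  change TensorProduct.map q q t = t
  rw [← LinearMap.lTensor_comp_rTensor, LinearMap.comp_apply, h2, h1]

variable (δ δne : C →ₗ[K] C ⊗[K] C)

/-- The `n`-th term of the coradical filtration: the elements killed by all iterated coproducts
with more than `n` tensor factors. -/
def coradical (n : ℕ) : Submodule K C :=
  ⨅ t : CoShape, ⨅ _ : n < t.leaves, LinearMap.ker (iteratedCoproduct δ δne t)

variable {δ δne}

theorem mem_coradical {n : ℕ} {c : C} :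
    c ∈ coradical δ δne n ↔ ∀ t : CoShape, n < t.leaves → iteratedCoproduct δ δne t c = 0 := by
  simp [coradical]

theorem coradical_mono : Monotone (coradical δ δne) := fun _ _ hij _ hc =>
  mem_coradical.2 fun t ht => mem_coradical.1 hc t (hij.trans_lt ht)

theorem eq_zero_of_mem_coradical_zero {c : C} (hc : c ∈ coradical δ δne 0) : c = 0 :=
  TensorAlgebra.ι_leftInverse.injective
    ((mem_coradical.1 hc .leaf Nat.zero_lt_one).trans (map_zero (TensorAlgebra.ι K)).symm)

theorem IsConnectedCoalgebra.exists_mem_coradical (h : IsConnectedCoalgebra δ δne) (c : C) :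
    ∃ n, c ∈ coradical δ δne n := by
  obtain ⟨N, hN⟩ := h c
  refine ⟨N, mem_coradical.2 fun t ht => hN (t.leaves - 1) (by omega) t (by omega)⟩

/-- A coproduct `d` takes values in `D ⊗ D`, `D` the `n`-th term of the filtration, on any element
killed by the composites of `d` with iterated coproducts, having more than `n` tensor factors, of
one of the two factors. -/
theorem tensorSquare_of_iterated {n : ℕ} (d : C →ₗ[K] C ⊗[K] C) (c : C)
    (hl : ∀ t : CoShape, n < t.leaves → LinearMap.mul' K (TensorAlgebra K C)
      (TensorProduct.map (TensorAlgebra.ι K) (iteratedCoproduct δ δne t) (d c)) = 0)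
    (hr : ∀ t : CoShape, n < t.leaves → LinearMap.mul' K (TensorAlgebra K C)
      (TensorProduct.map (iteratedCoproduct δ δne t) (TensorAlgebra.ι K) (d c)) = 0) :
    d c ∈ (coradical δ δne n).tensorSquare := by
  refine Submodule.mem_tensorSquare_of_contract _ _ (fun l => ?_) fun l => ?_
  · refine mem_coradical.2 fun t ht => ?_
    obtain ⟨D, hD⟩ := TensorAlgebra.exists_contractLeft l
    rw [← map_zero D, ← hl t ht]
    generalize d c = s
    induction s with
    | zero => simp
    | tmul x y => simp [hD]
    | add x y hx hy => simp only [map_add, hx, hy]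
  · refine mem_coradical.2 fun t ht => ?_
    obtain ⟨D, hD⟩ := TensorAlgebra.exists_contractRight l
    rw [← map_zero D, ← hr t ht]
    generalize d c = s
    induction s with
    | zero => simp
    | tmul x y => simp [hD]
    | add x y hx hy => simp only [map_add, hx, hy]

theorem comul_mem_tensorSquare {n : ℕ} {c : C} (hc : c ∈ coradical δ δne (n + 1)) :
    δ c ∈ (coradical δ δne n).tensorSquare :=
  tensorSquare_of_iterated δ c
    (fun t ht => mem_coradical.1 hc (.node .leaf t) (by simp only [CoShape.leaves]; omega))
    (fun t ht => mem_coradical.1 hc (.node t .leaf) (by simp only [CoShape.leaves]; omega))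

theorem comulNE_mem_tensorSquare {n : ℕ} {c : C} (hc : c ∈ coradical δ δne (n + 1)) :
    δne c ∈ (coradical δ δne n).tensorSquare :=
  tensorSquare_of_iterated δne c
    (fun t ht => mem_coradical.1 hc (.nodeNE .leaf t) (by simp only [CoShape.leaves]; omega))
    (fun t ht => mem_coradical.1 hc (.nodeNE t .leaf) (by simp only [CoShape.leaves]; omega))

/-- Induction along the coradical filtration: an element may be assumed to have coproducts in
`S ⊗ S`, where the claim holds on the subspace `S`. -/
theorem IsConnectedCoalgebra.induction (h : IsConnectedCoalgebra δ δne) {p : C → Prop}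
    (zero : p 0)
    (step : ∀ (S : Submodule K C) (c : C), (∀ x ∈ S, p x) →
      δ c ∈ S.tensorSquare → δne c ∈ S.tensorSquare → p c) (c : C) : p c := by
  have key : ∀ n, ∀ c ∈ coradical δ δne n, p c := by
    intro n
    induction n with
    | zero => intro c hc; rw [eq_zero_of_mem_coradical_zero hc]; exact zero
    | succ n ih =>
      exact fun c hc => step _ c ih (comul_mem_tensorSquare hc) (comulNE_mem_tensorSquare hc)
  obtain ⟨n, hn⟩ := h.exists_mem_coradical c
  exact key n c hn

/-- Recursion along the coradical filtration: an operator `Φ` on linear maps such that `Φ g` on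
one term of the filtration depends only on `g` on the preceding term has a fixed point. -/
theorem IsConnectedCoalgebra.exists_fixedPoint (h : IsConnectedCoalgebra δ δne)
    {A : Type w} [AddCommGroup A] [Module K A] (Φ : (C →ₗ[K] A) → (C →ₗ[K] A))
    (hΦ : ∀ (n : ℕ) (g g' : C →ₗ[K] A), (∀ x ∈ coradical δ δne n, g x = g' x) →
      ∀ x ∈ coradical δ δne (n + 1), Φ g x = Φ g' x) :
    ∃ g, Φ g = g := by
  let s : ℕ → C →ₗ[K] A := fun n => Φ^[n] 0
  have s_succ : ∀ n, s (n + 1) = Φ (s n) := fun n => Function.iterate_succ_apply' Φ n 0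
  have hs1 : ∀ n, ∀ x ∈ coradical δ δne n, s (n + 1) x = s n x := by
    intro n
    induction n with
    | zero => intro x hx; simp [eq_zero_of_mem_coradical_zero hx]
    | succ n ih =>
      intro x hx
      rw [s_succ (n + 1), hΦ n _ _ ih x hx, ← s_succ]
  have hs : ∀ n k, n ≤ k → ∀ x ∈ coradical δ δne n, s k x = s n x := by
    intro n k hnk x hx
    induction k, hnk using Nat.le_induction with
    | base => rfl
    | succ k hk ih => rw [hs1 k x (coradical_mono hk hx), ih]
  choose N hN using h.exists_mem_coradical
  have hval : ∀ n, ∀ x ∈ coradical δ δne n, s (N x) x = s n x := fun n x hx => by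
    rw [← hs _ _ (le_max_left (N x) n) x (hN x), hs _ _ (le_max_right (N x) n) x hx]
  let g : C →ₗ[K] A :=
    { toFun := fun x => s (N x) x
      map_add' := fun x y => by
        have hx := coradical_mono (le_max_left (N x) (N y)) (hN x)
        have hy := coradical_mono (le_max_right (N x) (N y)) (hN y)
        rw [hval _ _ (add_mem hx hy), hval _ _ hx, hval _ _ hy, map_add]
      map_smul' := fun c x => by
        rw [hval _ _ (Submodule.smul_mem _ c (hN x)), map_smul, RingHom.id_apply] }
  refine ⟨g, LinearMap.ext fun x => ?_⟩
  have hx := coradical_mono (Nat.le_succ (N x)) (hN x)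
  rw [hΦ (N x) g (s (N x)) (fun y hy => hval _ y hy) x hx, ← s_succ]
  exact (hval _ x hx).symm

end Filtration

/-! ### Projections of a connected double bialgebra -/

section

variable {K : Type u} [Field K] {A : Type v} [AddCommGroup A] [Module K A]

open TensorProduct in
theorem rTensor_lift_assoc_symm {X Y Z W : Type*} [AddCommGroup X] [Module K X]
    [AddCommGroup Y] [Module K Y] [AddCommGroup Z] [Module K Z] [AddCommGroup W] [Module K W]
    (B : X →ₗ[K] Y →ₗ[K] W) (x : X) (t : Y ⊗[K] Z) :
    (lift B).rTensor Z ((TensorProduct.assoc K X Y Z).symm (x ⊗ₜ t)) = (B x).rTensor Z t := by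
  induction t with
  | zero => simp
  | tmul y z => simp
  | add s t hs ht => rw [tmul_add, map_add, map_add, hs, ht, map_add]

open TensorProduct in
/-- In Sweedler notation, both sides are `B(x', x'') ⊗ x'''` for the two iterated coproducts of
a coassociativity relation. -/
theorem rTensor_lift_of_assoc_eq {W : Type*} [AddCommGroup W] [Module K W]
    {d d' : A →ₗ[K] A ⊗[K] A} {s t : A ⊗[K] A}
    (h : TensorProduct.assoc K A A A (d.rTensor A s) = d'.lTensor A t)
    (B : A →ₗ[K] A →ₗ[K] W) :
    (lift B).rTensor A ((TensorProduct.assoc K A A A).symm (d'.lTensor A t)) =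
      (lift B ∘ₗ d).rTensor A s := by
  rw [← h, LinearEquiv.symm_apply_apply, LinearMap.rTensor_comp, LinearMap.comp_apply]

/-- `e` is the projection onto `Ker Δ` along `A ↗ A`, characterized by
`x = e(x) + e(x') ↗ x''`. -/
structure IsKerProjection (ne : A →ₗ[K] A →ₗ[K] A) (Δ Δne : A →ₗ[K] A ⊗[K] A)
    (e : A →ₗ[K] A) : Prop where
  decomp : ∀ x, e x + TensorProduct.lift (ne ∘ₗ e) (Δ x) = x
  comul : ∀ x, Δ (e x) = 0
  comulNE : ∀ x, Δne (e x) = e.rTensor A (Δne x)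
  map_ne : ∀ x y, e (ne x y) = 0

/-- `π` is the projection onto the space of primitive elements along `A A + A ↗ A`. -/
structure IsPrimProjection (m ne : A →ₗ[K] A →ₗ[K] A) (Δ Δne : A →ₗ[K] A ⊗[K] A)
    (π : A →ₗ[K] A) : Prop where
  comul : ∀ x, Δ (π x) = 0
  comulNE : ∀ x, Δne (π x) = 0
  eq_self : ∀ x, Δ x = 0 → Δne x = 0 → π x = x
  map_m : ∀ x y, π (m x y) = 0
  map_ne : ∀ x y, π (ne x y) = 0

variable {m ne : A →ₗ[K] A →ₗ[K] A} {Δ Δne : A →ₗ[K] A ⊗[K] A}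

theorem IsKerProjection.eq_self {e : A →ₗ[K] A} (he : IsKerProjection ne Δ Δne e) {x : A}
    (hx : Δ x = 0) : e x = x := by
  simpa [hx] using he.decomp x

open TensorProduct in
/-- `e(x y)` depends on `x` through `e(x)` only, because `(x ↗ y) z = x ↗ (y z)`. -/
theorem IsKerProjection.map_m_map {e : A →ₗ[K] A} (he : IsKerProjection ne Δ Δne e)
    (hA : IsNEAlgebra m ne) (x y : A) : e (m (e x) y) = e (m x y) := by
  have key : ∀ u : A ⊗[K] A, e (m (lift (ne ∘ₗ e) u) y) = 0 := fun u => by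
    induction u with
    | zero => simp
    | tmul a b => simp [hA.ne_m, he.map_ne]
    | add a b ha hb => simp only [map_add, LinearMap.add_apply, ha, hb, add_zero]
  conv_rhs => rw [← he.decomp x, map_add, LinearMap.add_apply, map_add, key, add_zero]

open TensorProduct in
theorem IsDoubleBialgebra.exists_kerProjection (H : IsDoubleBialgebra m ne Δ Δne)
    (hc : IsConnectedCoalgebra Δ Δne) : ∃ e, IsKerProjection ne Δ Δne e := by
  obtain ⟨e, he⟩ := hc.exists_fixedPoint
    (fun e : A →ₗ[K] A => LinearMap.id - lift (ne ∘ₗ e) ∘ₗ Δ) (fun n g g' hg x hx => by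
      simp only [LinearMap.sub_apply, LinearMap.comp_apply]
      congr 1
      exact Submodule.eq_of_mem_tensorSquare (fun x hx y _ => by simp [hg x hx])
        (comul_mem_tensorSquare hx))
  have dec : ∀ x, e x + lift (ne ∘ₗ e) (Δ x) = x := fun x => by
    conv_lhs => enter [1]; rw [← he]
    simp
  have eeq : ∀ x, e x = x - lift (ne ∘ₗ e) (Δ x) := fun x => eq_sub_of_add_eq (dec x)
  have hcomp : lift (ne ∘ₗ e) ∘ₗ Δ = LinearMap.id - e := LinearMap.ext fun x => by
    simp [eeq x]
  refine ⟨e, dec, ?_, ?_, ?_⟩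
  · refine hc.induction (by simp) fun S x ih hx _ => ?_
    have key : Δ (lift (ne ∘ₗ e) (Δ x)) =
        (lift (ne ∘ₗ e)).rTensor A ((TensorProduct.assoc K A A A).symm (Δ.lTensor A (Δ x))) +
          e.rTensor A (Δ x) := by
      refine Submodule.eq_of_mem_tensorSquare (f := Δ ∘ₗ lift (ne ∘ₗ e))
        (g := (lift (ne ∘ₗ e)).rTensor A ∘ₗ (TensorProduct.assoc K A A A).symm.toLinearMap ∘ₗ
          Δ.lTensor A + e.rTensor A) (fun a ha b _ => ?_) hx
      simp [H.comul_ne, ih a ha, rTensor_lift_assoc_symm]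
    rw [eeq, map_sub, key, rTensor_lift_of_assoc_eq (H.coalg.coassoc x), hcomp,
      LinearMap.rTensor_sub, LinearMap.sub_apply, LinearMap.rTensor_id, LinearMap.id_apply]
    abel
  · intro x
    have key : ∀ u, Δne (lift (ne ∘ₗ e) u) =
        (lift (ne ∘ₗ e)).rTensor A ((TensorProduct.assoc K A A A).symm (Δne.lTensor A u)) :=
      fun u => by
        induction u with
        | zero => simp
        | tmul a b => simp [H.comulNE_ne, rTensor_lift_assoc_symm]
        | add a b ha hb => simp only [map_add, ha, hb]
    rw [eeq, map_sub, key, rTensor_lift_of_assoc_eq (H.coalg.mixed x), hcomp,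
      LinearMap.rTensor_sub, LinearMap.sub_apply, LinearMap.rTensor_id, LinearMap.id_apply]
    abel
  · intro x
    refine hc.induction (by simp) fun S y ih hy _ => ?_
    have h1 : lift (ne ∘ₗ e) ((ne x).rTensor A (Δ y)) = 0 :=
      Submodule.eq_of_mem_tensorSquare (f := lift (ne ∘ₗ e) ∘ₗ (ne x).rTensor A) (g := 0)
        (fun a ha b _ => by simp [ih a ha]) hy
    have h2 : ∀ u, lift (ne ∘ₗ e) ((ne.flip y).lTensor A u) = ne (lift (ne ∘ₗ e) u) y :=
      fun u => by
        induction u with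
        | zero => simp
        | tmul a b => simp [H.alg.ne_assoc]
        | add a b ha hb => simp only [map_add, LinearMap.add_apply, ha, hb]
    rw [eeq, H.comul_ne, map_add, map_add, h1, h2, lift.tmul, LinearMap.comp_apply, zero_add,
      ← LinearMap.add_apply, ← map_add, add_comm, dec, sub_self]

open TensorProduct in
/-- The projection onto the primitive elements, defined by the recursion
`π(x) = e(x) - e(π(x') x'')`, where `x' ⊗ x''` is the second coproduct of `x`. -/
theorem IsKerProjection.exists_primProjection {e : A →ₗ[K] A}
    (he : IsKerProjection ne Δ Δne e) (H : IsDoubleBialgebra m ne Δ Δne)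
    (hc : IsConnectedCoalgebra Δ Δne) : ∃ π, IsPrimProjection m ne Δ Δne π := by
  obtain ⟨π, hπ⟩ := hc.exists_fixedPoint
    (fun π : A →ₗ[K] A => e - e ∘ₗ lift (m ∘ₗ π) ∘ₗ Δne) (fun n g g' hg x hx => by
      simp only [LinearMap.sub_apply, LinearMap.comp_apply]
      congr 2
      exact Submodule.eq_of_mem_tensorSquare (fun x hx y _ => by simp [hg x hx])
        (comulNE_mem_tensorSquare hx))
  have πeq : ∀ x, π x = e x - e (lift (m ∘ₗ π) (Δne x)) := fun x => by
    conv_lhs => rw [← hπ]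
    simp
  have hcomp : e ∘ₗ lift (m ∘ₗ π) ∘ₗ Δne = e - π := LinearMap.ext fun x => by
    simp [πeq x]
  have hΔ : ∀ x, Δ (π x) = 0 := fun x => by rw [πeq, map_sub, he.comul, he.comul, sub_self]
  have hne : ∀ x y, π (ne x y) = 0 := fun x => by
    refine hc.induction (by simp) fun S y ih _ hy => ?_
    have h1 : lift (m ∘ₗ π) ((ne x).rTensor A (Δne y)) = 0 :=
      Submodule.eq_of_mem_tensorSquare (f := lift (m ∘ₗ π) ∘ₗ (ne x).rTensor A) (g := 0)
        (fun a ha b _ => by simp [ih a ha]) hy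
    rw [πeq, he.map_ne, H.comulNE_ne, h1, map_zero, sub_self]
  refine ⟨π, hΔ, ?_, ?_, ?_, hne⟩
  · refine hc.induction (by simp) fun S x ih _ hx => ?_
    have key : Δne (e (lift (m ∘ₗ π) (Δne x))) =
        e.rTensor A ((lift (m ∘ₗ π)).rTensor A
          ((TensorProduct.assoc K A A A).symm (Δne.lTensor A (Δne x)))) + π.rTensor A (Δne x) := by
      refine Submodule.eq_of_mem_tensorSquare (f := Δne ∘ₗ e ∘ₗ lift (m ∘ₗ π))
        (g := e.rTensor A ∘ₗ (lift (m ∘ₗ π)).rTensor A ∘ₗ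
          (TensorProduct.assoc K A A A).symm.toLinearMap ∘ₗ
          Δne.lTensor A + π.rTensor A) (fun a ha b _ => ?_) hx
      simp [he.comulNE, H.comulNE_m, ih a ha, rTensor_lift_assoc_symm, he.eq_self (hΔ a)]
    rw [πeq, map_sub, key, rTensor_lift_of_assoc_eq (H.coalg.coassoc_ne x),
      ← LinearMap.comp_apply (e.rTensor A), ← LinearMap.rTensor_comp, hcomp,
      LinearMap.rTensor_sub, LinearMap.sub_apply, he.comulNE]
    abel
  · intro x hx hx'
    simp [πeq x, hx', he.eq_self hx]
  · intro x
    refine hc.induction (by simp) fun S y ih _ hy => ?_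
    have h1 : lift (m ∘ₗ π) ((m x).rTensor A (Δne y)) = 0 :=
      Submodule.eq_of_mem_tensorSquare (f := lift (m ∘ₗ π) ∘ₗ (m x).rTensor A) (g := 0)
        (fun a ha b _ => by simp [ih a ha]) hy
    have h2 : ∀ u, lift (m ∘ₗ π) ((m.flip y).lTensor A u) = m (lift (m ∘ₗ π) u) y :=
      fun u => by
        induction u with
        | zero => simp
        | tmul a b => simp [H.alg.m_assoc]
        | add a b ha hb => simp only [map_add, LinearMap.add_apply, ha, hb]
    have h3 : e (lift (m ∘ₗ π) (Δne x)) + π x = e x := by rw [πeq x]; abel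
    rw [πeq, H.comulNE_m, map_add (lift _), map_add (lift _), h1, h2, lift.tmul,
      LinearMap.comp_apply, zero_add, map_add, ← he.map_m_map H.alg (lift _ _),
      ← map_add, ← LinearMap.add_apply, ← map_add, h3,
      he.map_m_map H.alg, sub_self]

/-! ### Cofreeness -/

variable {C : Type w} [AddCommGroup C] [Module K C] {δ δne : C →ₗ[K] C ⊗[K] C}

open TensorProduct in
/-- A coalgebra morphism from a connected coalgebra is determined by its composite with the
projection on the primitive elements. -/
theorem IsPrimProjection.hom_ext {π : A →ₗ[K] A} (hπ : IsPrimProjection m ne Δ Δne π)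
    (hc : IsConnectedCoalgebra δ δne) {g g' : C →ₗ[K] A}
    (hg : IsCoalgebraHom δ δne Δ Δne g) (hg' : IsCoalgebraHom δ δne Δ Δne g')
    (h : ∀ x, π (g x) = π (g' x)) : g = g' := by
  refine LinearMap.ext (hc.induction (by simp) fun S x ih hx hx' => ?_)
  have key : ∀ t ∈ S.tensorSquare, map g g t = map g' g' t := fun t ht =>
    Submodule.eq_of_mem_tensorSquare (fun a ha b hb => by simp [ih a ha, ih b hb]) ht
  have := hπ.eq_self (g x - g' x) (by rw [map_sub, hg.comul, hg'.comul, key _ hx, sub_self])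
    (by rw [map_sub, hg.comulNE, hg'.comulNE, key _ hx', sub_self])
  rw [← sub_eq_zero, ← this, map_sub, h, sub_self]

open TensorProduct in
/-- A linear map to the primitive elements lifts to a coalgebra morphism `g`, defined by the
recursion `g(x) = p(x) + p(x') ↗ g(x'')`, `p(x) = f(x) + e(f(x') g(x''))`, with the first
coproduct in the formula for `g` and the second one in the formula for `p`. -/
theorem IsPrimProjection.exists_lift {π : A →ₗ[K] A} (hπ : IsPrimProjection m ne Δ Δne π)
    {e : A →ₗ[K] A} (he : IsKerProjection ne Δ Δne e) (H : IsDoubleBialgebra m ne Δ Δne)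
    (hδ : IsOpNECoalgebra δ δne) (hc : IsConnectedCoalgebra δ δne) (f : C →ₗ[K] A)
    (hf : ∀ x, Δ (f x) = 0) (hf' : ∀ x, Δne (f x) = 0) :
    ∃ g : C →ₗ[K] A, IsCoalgebraHom δ δne Δ Δne g ∧ ∀ x, π (g x) = f x := by
  let P : (C →ₗ[K] A) → C →ₗ[K] A := fun g => f + e ∘ₗ lift (m.compl₁₂ f g) ∘ₗ δne
  have hP : ∀ (n : ℕ) (g g' : C →ₗ[K] A), (∀ x ∈ coradical δ δne n, g x = g' x) →
      ∀ x ∈ coradical δ δne (n + 1), P g x = P g' x := fun n g g' hg x hx => by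
    simp only [P, LinearMap.add_apply, LinearMap.comp_apply]
    congr 2
    exact Submodule.eq_of_mem_tensorSquare (fun x _ y hy => by simp [hg y hy])
      (comulNE_mem_tensorSquare hx)
  obtain ⟨g, hg⟩ := hc.exists_fixedPoint
    (fun g : C →ₗ[K] A => P g + lift (ne.compl₁₂ (P g) g) ∘ₗ δ) (fun n g g' hg x hx => by
      simp only [LinearMap.add_apply, LinearMap.comp_apply]
      rw [hP n g g' hg x hx]
      congr 1
      refine Submodule.eq_of_mem_tensorSquare (fun x hx y hy => ?_) (comul_mem_tensorSquare hx)
      simp [hg y hy, hP n g g' hg x (coradical_mono n.le_succ hx)])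
  obtain ⟨p, hp⟩ : ∃ p, p = P g := ⟨_, rfl⟩
  rw [← hp] at hg
  have peq : ∀ x, p x = f x + e (lift (m.compl₁₂ f g) (δne x)) := fun x => by simp [hp, P]
  have geq : ∀ x, g x = p x + lift (ne.compl₁₂ p g) (δ x) := fun x => by
    conv_lhs => rw [← hg]
    simp
  have hpΔ : ∀ x, Δ (p x) = 0 := fun x => by rw [peq, map_add, hf, he.comul, add_zero]
  have πe : ∀ x, π (e x) = π x := fun x => by
    have key : ∀ u : A ⊗[K] A, π (lift (ne ∘ₗ e) u) = 0 := fun u => by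
      induction u with
      | zero => simp
      | tmul a b => simp [hπ.map_ne]
      | add a b ha hb => simp only [map_add, ha, hb, add_zero]
    conv_rhs => rw [← he.decomp x, map_add, key, add_zero]
  refine ⟨g, ?_, fun x => ?_⟩
  · suffices h : ∀ x, Δ (g x) = map g g (δ x) ∧ Δne (g x) = map g g (δne x) from
      ⟨fun x => (h x).1, fun x => (h x).2⟩
    have hgg : ∀ u : C ⊗[K] C, map g g u =
        g.lTensor A ((lift (ne.compl₁₂ p g) ∘ₗ δ).rTensor C u) + map p g u := fun u => by
      induction u with
      | zero => simp
      | tmul a b => simp [geq a, add_tmul, add_comm]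
      | add a b ha hb => simp only [map_add, ha, hb]; abel
    have hB : ∀ (B : A →ₗ[K] A →ₗ[K] A) (q : C →ₗ[K] A) (x : C) (u : C ⊗[K] C),
        (B (q x)).rTensor A (map g g u) = g.lTensor A ((lift (B.compl₁₂ q g)).rTensor C
          ((TensorProduct.assoc K C C C).symm (x ⊗ₜ u))) := fun B q x u => by
      rw [rTensor_lift_assoc_symm]
      induction u with
      | zero => simp
      | tmul a b => simp
      | add a b ha hb => simp only [map_add, ha, hb]
    refine hc.induction (by simp) fun S x ih hx hx' => ⟨?_, ?_⟩
    · have key : Δ (lift (ne.compl₁₂ p g) (δ x)) = g.lTensor A ((lift (ne.compl₁₂ p g)).rTensor C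
          ((TensorProduct.assoc K C C C).symm (δ.lTensor C (δ x)))) + map p g (δ x) := by
        refine Submodule.eq_of_mem_tensorSquare (f := Δ ∘ₗ lift (ne.compl₁₂ p g))
          (g := g.lTensor A ∘ₗ (lift (ne.compl₁₂ p g)).rTensor C ∘ₗ
            (TensorProduct.assoc K C C C).symm.toLinearMap ∘ₗ δ.lTensor C + map p g)
          (fun a ha b hb => ?_) hx
        simp [H.comul_ne, hpΔ, (ih b hb).1, hB]
      rw [hgg, geq, map_add, hpΔ, key, rTensor_lift_of_assoc_eq (hδ.coassoc x), zero_add]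
    · have key1 : Δne (e (lift (m.compl₁₂ f g) (δne x))) =
          e.rTensor A (g.lTensor A ((lift (m.compl₁₂ f g)).rTensor C
            ((TensorProduct.assoc K C C C).symm (δne.lTensor C (δne x))))) +
          map f g (δne x) := by
        refine Submodule.eq_of_mem_tensorSquare (f := Δne ∘ₗ e ∘ₗ lift (m.compl₁₂ f g))
          (g := e.rTensor A ∘ₗ g.lTensor A ∘ₗ (lift (m.compl₁₂ f g)).rTensor C ∘ₗ
            (TensorProduct.assoc K C C C).symm.toLinearMap ∘ₗ δne.lTensor C + map f g)
          (fun a ha b hb => ?_) hx'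
        simp [he.comulNE, H.comulNE_m, hf', (ih b hb).2, hB, he.eq_self (hf a)]
      have key2 : Δne (p x) = map p g (δne x) := by
        rw [peq, map_add, hf', key1, rTensor_lift_of_assoc_eq (hδ.coassoc_ne x), zero_add]
        generalize δne x = t
        induction t with
        | zero => simp
        | tmul a b => simp [peq a, add_tmul, add_comm]
        | add a b ha hb => simp only [map_add, ← ha, ← hb]; abel
      have key3 : Δne (lift (ne.compl₁₂ p g) (δ x)) =
          g.lTensor A ((lift (ne.compl₁₂ p g)).rTensor C
            ((TensorProduct.assoc K C C C).symm (δne.lTensor C (δ x)))) := by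
        refine Submodule.eq_of_mem_tensorSquare (f := Δne ∘ₗ lift (ne.compl₁₂ p g))
          (g := g.lTensor A ∘ₗ (lift (ne.compl₁₂ p g)).rTensor C ∘ₗ
            (TensorProduct.assoc K C C C).symm.toLinearMap ∘ₗ δne.lTensor C)
          (fun a ha b hb => ?_) hx
        simp [H.comulNE_ne, (ih b hb).2, hB]
      rw [hgg, geq, map_add, key2, key3, rTensor_lift_of_assoc_eq (hδ.mixed x), add_comm]
  · have key : ∀ u : C ⊗[K] C, π (lift (ne.compl₁₂ p g) u) = 0 := fun u => by
      induction u with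
      | zero => simp
      | tmul a b => simp [hπ.map_ne]
      | add a b ha hb => simp only [map_add, ha, hb, add_zero]
    have key' : ∀ u : C ⊗[K] C, π (lift (m.compl₁₂ f g) u) = 0 := fun u => by
      induction u with
      | zero => simp
      | tmul a b => simp [hπ.map_m]
      | add a b ha hb => simp only [map_add, ha, hb, add_zero]
    rw [geq, peq, map_add, map_add, key, πe, key', hπ.eq_self _ (hf x) (hf' x), add_zero, add_zero]

end

/-! ### Infinitesimal compatibilities -/

section

variable {K : Type u} [Field K] {A : Type v} [AddCommGroup A] [Module K A]

/-- The compatibility `Δ(x y) = x y' ⊗ y'' + ε (x' ⊗ x'' y + x ⊗ y)` of a coproduct with the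
product `μ`. The four compatibilities of a double bialgebra are the cases `ε = 1` and, for the
second coproduct and the product `↗`, `ε = 0`. -/
def IsInfinitesimal (ε : K) (μ : A →ₗ[K] A →ₗ[K] A) (Δ : A →ₗ[K] A ⊗[K] A) : Prop :=
  ∀ x y, Δ (μ x y) = (μ x).rTensor A (Δ y) + ε • ((μ.flip y).lTensor A (Δ x) + x ⊗ₜ[K] y)

section

variable {m ne : A →ₗ[K] A →ₗ[K] A} {Δ Δne : A →ₗ[K] A ⊗[K] A}

theorem IsDoubleBialgebra.comul_isInfinitesimal_m (H : IsDoubleBialgebra m ne Δ Δne) :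
    IsInfinitesimal 1 m Δ := fun x y => by rw [H.comul_m, one_smul, add_assoc]

theorem IsDoubleBialgebra.comul_isInfinitesimal_ne (H : IsDoubleBialgebra m ne Δ Δne) :
    IsInfinitesimal 1 ne Δ := fun x y => by rw [H.comul_ne, one_smul, add_assoc]

theorem IsDoubleBialgebra.comulNE_isInfinitesimal_m (H : IsDoubleBialgebra m ne Δ Δne) :
    IsInfinitesimal 1 m Δne := fun x y => by rw [H.comulNE_m, one_smul, add_assoc]

theorem IsDoubleBialgebra.comulNE_isInfinitesimal_ne (H : IsDoubleBialgebra m ne Δ Δne) :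
    IsInfinitesimal 0 ne Δne := fun x y => by rw [H.comulNE_ne, zero_smul, add_zero]

end

open TensorProduct in
/-- The set of elements satisfying a coassociativity relation is stable under a product
compatible with both coproducts, provided that `ε η = η`. -/
theorem IsInfinitesimal.coassoc {ε η : K} (hεη : ε * η = η) {μ : A →ₗ[K] A →ₗ[K] A}
    {a b : A →ₗ[K] A ⊗[K] A} (ha : IsInfinitesimal ε μ a) (hb : IsInfinitesimal η μ b) {x y : A}
    (hx : TensorProduct.assoc K A A A (a.rTensor A (b x)) = b.lTensor A (a x))
    (hy : TensorProduct.assoc K A A A (a.rTensor A (b y)) = b.lTensor A (a y)) :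
    TensorProduct.assoc K A A A (a.rTensor A (b (μ x y))) = b.lTensor A (a (μ x y)) := by
  -- `G u` is the map `s' ⊗ s'' ↦ s' ⊗ s'' u' ⊗ u''`.
  let G : A ⊗[K] A → (A ⊗[K] A →ₗ[K] A ⊗[K] (A ⊗[K] A)) := fun u =>
    ((LinearMap.rTensorHom A ∘ₗ μ).flip u).lTensor A
  have G_tmul : ∀ p q s, G (p ⊗ₜ q) s =
      TensorProduct.assoc K A A A ((μ.flip p).lTensor A s ⊗ₜ q) := fun p q s => by
    induction s with
    | zero => simp
    | tmul s t => simp [G]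
    | add s t hs ht => simp only [map_add, hs, ht, add_tmul]
  have G_add : ∀ s t, G (s + t) = G s + G t := fun s t => by
    simp only [G, map_add, LinearMap.lTensor_add]
  have h1 : ∀ u, TensorProduct.assoc K A A A (a.rTensor A ((μ x).rTensor A u)) =
      (μ x).rTensor (A ⊗[K] A) (TensorProduct.assoc K A A A (a.rTensor A u)) +
        ε • (G u (a x) + x ⊗ₜ u) := fun u => by
    induction u with
    | zero => simp [G]
    | tmul p q =>
      have : ∀ s : A ⊗[K] A, TensorProduct.assoc K A A A ((μ x).rTensor A s ⊗ₜ q) =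
          (μ x).rTensor (A ⊗[K] A) (TensorProduct.assoc K A A A (s ⊗ₜ q)) := fun s => by
        induction s with
        | zero => simp
        | tmul s t => simp
        | add s t hs ht => simp only [map_add, hs, ht, add_tmul]
      simp only [LinearMap.rTensor_tmul, ha x p, add_tmul, ← smul_tmul', map_add, map_smul, this,
        G_tmul, TensorProduct.assoc_tmul]
    | add s t hs ht =>
      simp only [map_add, hs, ht, G_add, LinearMap.add_apply, tmul_add, smul_add]; abel
  have h2 : ∀ u : A ⊗[K] A, TensorProduct.assoc K A A A (a.rTensor A ((μ.flip y).lTensor A u)) =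
      ((μ.flip y).lTensor A).lTensor A (TensorProduct.assoc K A A A (a.rTensor A u)) := fun u => by
    induction u with
    | zero => simp
    | tmul p q =>
      have : ∀ s : A ⊗[K] A, TensorProduct.assoc K A A A (s ⊗ₜ μ q y) =
          ((μ.flip y).lTensor A).lTensor A (TensorProduct.assoc K A A A (s ⊗ₜ q)) := fun s => by
        induction s with
        | zero => simp
        | tmul s t => simp
        | add s t hs ht => simp only [map_add, hs, ht, add_tmul]
      simp [this]
    | add s t hs ht => simp only [map_add, hs, ht]
  have h3 : ∀ u : A ⊗[K] A, b.lTensor A ((μ x).rTensor A u) =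
      (μ x).rTensor (A ⊗[K] A) (b.lTensor A u) := fun u => by
    induction u with
    | zero => simp
    | tmul p q => simp
    | add s t hs ht => simp only [map_add, hs, ht]
  have h4 : ∀ s : A ⊗[K] A, b.lTensor A ((μ.flip y).lTensor A s) = G (b y) s +
      η • (((μ.flip y).lTensor A).lTensor A (b.lTensor A s) +
        TensorProduct.assoc K A A A (s ⊗ₜ y)) := fun s => by
    induction s with
    | zero => simp
    | tmul p q => simp [G, hb q y, tmul_add]
    | add s t hs ht => simp only [map_add, hs, ht, add_tmul, smul_add]; abel
  simp only [ha x y, hb x y, map_add, map_smul, h1, h2, h3, h4, hx, hy, LinearMap.rTensor_tmul,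
    LinearMap.lTensor_tmul, smul_add, smul_smul, hεη]
  abel

open TensorProduct in
/-- The set of elements at which an algebra morphism commutes with coproducts is stable under
products, if the same compatibility holds on both sides. -/
theorem IsInfinitesimal.map_comul {B : Type w} [AddCommGroup B] [Module K B] {ε : K}
    {μ : A →ₗ[K] A →ₗ[K] A} {Δ : A →ₗ[K] A ⊗[K] A} (h : IsInfinitesimal ε μ Δ)
    {ν : B →ₗ[K] B →ₗ[K] B} {δ : B →ₗ[K] B ⊗[K] B} (h' : IsInfinitesimal ε ν δ) {φ : B →ₗ[K] A}
    (hφ : ∀ x y, φ (ν x y) = μ (φ x) (φ y)) {x y : B}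
    (hx : Δ (φ x) = map φ φ (δ x)) (hy : Δ (φ y) = map φ φ (δ y)) :
    Δ (φ (ν x y)) = map φ φ (δ (ν x y)) := by
  have h1 : ∀ u, map φ φ ((ν x).rTensor B u) = (μ (φ x)).rTensor A (map φ φ u) := fun u => by
    induction u with
    | zero => simp
    | tmul p q => simp [hφ]
    | add s t hs ht => simp only [map_add, hs, ht]
  have h2 : ∀ u, map φ φ ((ν.flip y).lTensor B u) = (μ.flip (φ y)).lTensor A (map φ φ u) :=
    fun u => by
      induction u with
      | zero => simp
      | tmul p q => simp [hφ]
      | add s t hs ht => simp only [map_add, hs, ht]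
  simp only [hφ, h _ _, h' _ _, hx, hy, map_add, map_smul, h1, h2, map_tmul]

/-- The product `(x, u) (y, v) = (x y, x v + ε (u y + x ⊗ y))` on `A × (A ⊗ A)`. It is such that
`Δ` is compatible with the product of `A` if and only if `x ↦ (x, Δ x)` is multiplicative. -/
noncomputable def infinitesimalProd (ε : K) (μ : A →ₗ[K] A →ₗ[K] A) :
    A × (A ⊗[K] A) →ₗ[K] A × (A ⊗[K] A) →ₗ[K] A × (A ⊗[K] A) :=
  LinearMap.mk₂ K (fun p q => (μ p.1 q.1,
      (μ p.1).rTensor A q.2 + ε • ((μ.flip q.1).lTensor A p.2 + p.1 ⊗ₜ[K] q.1)))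
    (fun p p' q => by
      ext1
      · simp
      · simp [LinearMap.rTensor_add, TensorProduct.add_tmul]; abel)
    (fun c p q => by
      ext1
      · simp
      · simp [LinearMap.rTensor_smul, smul_comm c, TensorProduct.smul_tmul'])
    (fun p q q' => by
      ext1
      · simp
      · simp [LinearMap.lTensor_add, TensorProduct.tmul_add]; abel)
    (fun c p q => by
      ext1
      · simp
      · simp [LinearMap.lTensor_smul, smul_comm c])

theorem infinitesimalProd_apply (ε : K) (μ : A →ₗ[K] A →ₗ[K] A) (p q : A × (A ⊗[K] A)) :
    infinitesimalProd ε μ p q = (μ p.1 q.1,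
      (μ p.1).rTensor A q.2 + ε • ((μ.flip q.1).lTensor A p.2 + p.1 ⊗ₜ[K] q.1)) := rfl

open TensorProduct in
/-- Only `(x y) ↗ z = x (y ↗ z)`, the relation which is not imposed, would fail here for the values
`1` and `0` of the scalars attached to `m` and `↗`. -/
theorem infinitesimalProd_assoc {ε η : K} (h : η * ε = ε) {μ ν : A →ₗ[K] A →ₗ[K] A}
    (hμν : ∀ x y z, ν (μ x y) z = μ x (ν y z)) (p q r : A × (A ⊗[K] A)) :
    infinitesimalProd η ν (infinitesimalProd ε μ p q) r =
      infinitesimalProd ε μ p (infinitesimalProd η ν q r) := by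
  obtain ⟨x, s⟩ := p
  obtain ⟨y, t⟩ := q
  obtain ⟨z, u⟩ := r
  have h1 : ν (μ x y) = μ x ∘ₗ ν y := LinearMap.ext fun z => hμν x y z
  have h2 : μ.flip (ν y z) = ν.flip z ∘ₗ μ.flip y := LinearMap.ext fun x => (hμν x y z).symm
  have h3 : ∀ t : A ⊗[K] A, (ν.flip z).lTensor A ((μ x).rTensor A t) =
      (μ x).rTensor A ((ν.flip z).lTensor A t) := fun t => by
    rw [← LinearMap.comp_apply, ← LinearMap.comp_apply, LinearMap.lTensor_comp_rTensor,
      LinearMap.rTensor_comp_lTensor]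
  simp only [infinitesimalProd_apply, hμν, Prod.mk.injEq, true_and]
  simp only [h1, h2, LinearMap.rTensor_comp_apply, LinearMap.lTensor_comp_apply, map_add, map_smul,
    h3, LinearMap.lTensor_tmul, LinearMap.rTensor_tmul, smul_add, smul_smul, h,
    LinearMap.flip_apply]
  abel

end

/-! ### The free algebra -/

namespace FreeNE

variable {K : Type u} [Field K] {V : Type v} [AddCommGroup V] [Module K V]

/-- The class of a word in the free algebra. -/
noncomputable def word (t : NEWord V) : FreeNE K V := mk K V (Finsupp.single t 1)

theorem preM_single {V : Type v} (s t : NEWord V) (a b : K) :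
    preM K V (Finsupp.single s a) (Finsupp.single t b) = Finsupp.single (s.m t) (a * b) := by
  simp [preM, Finsupp.linearCombination_single]

theorem preNE_single {V : Type v} (s t : NEWord V) (a b : K) :
    preNE K V (Finsupp.single s a) (Finsupp.single t b) = Finsupp.single (s.ne t) (a * b) := by
  simp [preNE, Finsupp.linearCombination_single]

theorem mk_surjective : Function.Surjective (mk K V) := Submodule.mkQ_surjective _

theorem m_mk (x y : Pre K V) : m K V (mk K V x) (mk K V y) = mk K V (preM K V x y) := rfl

theorem ne_mk (x y : Pre K V) : ne K V (mk K V x) (mk K V y) = mk K V (preNE K V x y) := rfl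

theorem m_word (s t : NEWord V) : m K V (word s) (word t) = word (s.m t) := by
  rw [word, word, m_mk, preM_single, one_mul, word]

theorem ne_word (s t : NEWord V) : ne K V (word s) (word t) = word (s.ne t) := by
  rw [word, word, ne_mk, preNE_single, one_mul, word]

theorem word_of (x : V) : word (.of x) = ι K V x := rfl

theorem mem_of_word {S : Submodule K (FreeNE K V)} (h : ∀ t, word t ∈ S) (x : FreeNE K V) :
    x ∈ S := by
  obtain ⟨x, rfl⟩ := mk_surjective x
  induction x using Finsupp.induction_linear with
  | zero => simp
  | add x y hx hy => rw [map_add]; exact add_mem hx hy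
  | single t a =>
    rw [← mul_one a, ← smul_eq_mul, ← Finsupp.smul_single, map_smul]
    exact S.smul_mem a (h t)

/-- Induction on words: a subspace stable under both products and containing the generators is
everything. -/
theorem mem_of_generators {S : Submodule K (FreeNE K V)} (hι : ∀ x, ι K V x ∈ S)
    (hm : ∀ x ∈ S, ∀ y ∈ S, m K V x y ∈ S) (hne : ∀ x ∈ S, ∀ y ∈ S, ne K V x y ∈ S)
    (x : FreeNE K V) : x ∈ S := by
  refine mem_of_word (fun t => ?_) x
  induction t with
  | of v => exact hι v
  | m s t hs ht => rw [← m_word]; exact hm _ hs _ ht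
  | ne s t hs ht => rw [← ne_word]; exact hne _ hs _ ht

variable (K V) in
theorem isNEAlgebra : IsNEAlgebra (m K V) (ne K V) where
  ne_m x y z := by
    obtain ⟨⟨x, rfl⟩, ⟨y, rfl⟩, ⟨z, rfl⟩⟩ := mk_surjective x, mk_surjective y, mk_surjective z
    exact (Submodule.Quotient.eq _).2 ((relIdeal_isRelIdeal K V).ne_m x y z)
  m_assoc x y z := by
    obtain ⟨⟨x, rfl⟩, ⟨y, rfl⟩, ⟨z, rfl⟩⟩ := mk_surjective x, mk_surjective y, mk_surjective z
    exact (Submodule.Quotient.eq _).2 ((relIdeal_isRelIdeal K V).m_assoc x y z)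
  ne_assoc x y z := by
    obtain ⟨⟨x, rfl⟩, ⟨y, rfl⟩, ⟨z, rfl⟩⟩ := mk_surjective x, mk_surjective y, mk_surjective z
    exact (Submodule.Quotient.eq _).2 ((relIdeal_isRelIdeal K V).ne_assoc x y z)

section Lift

variable {A : Type w} [AddCommGroup A] [Module K A]

/-- The value of a word in an algebra. -/
def evalWord (m ne : A →ₗ[K] A →ₗ[K] A) (f : V →ₗ[K] A) : NEWord V → A
  | .of x => f x
  | .m s t => m (evalWord m ne f s) (evalWord m ne f t)
  | .ne s t => ne (evalWord m ne f s) (evalWord m ne f t)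

theorem exists_lift {μ ν : A →ₗ[K] A →ₗ[K] A} (hA : IsNEAlgebra μ ν) (f : V →ₗ[K] A) :
    ∃ φ : FreeNE K V →ₗ[K] A, IsNEAlgebraHom (m K V) (ne K V) μ ν φ ∧ ∀ x, φ (ι K V x) = f x := by
  let L : Pre K V →ₗ[K] A := Finsupp.linearCombination K (evalWord μ ν f)
  have Lm : ∀ x y, L (preM K V x y) = μ (L x) (L y) := fun x y => by
    induction x using Finsupp.induction_linear with
    | zero => simp
    | add x x' hx hx' => simp only [map_add, LinearMap.add_apply, hx, hx']
    | single s a =>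
      induction y using Finsupp.induction_linear with
      | zero => simp
      | add y y' hy hy' => simp only [map_add, hy, hy']
      | single t b =>
        simp only [L, preM_single, Finsupp.linearCombination_single, evalWord, map_smul,
          LinearMap.smul_apply, mul_smul, smul_comm a b]
  have Lne : ∀ x y, L (preNE K V x y) = ν (L x) (L y) := fun x y => by
    induction x using Finsupp.induction_linear with
    | zero => simp
    | add x x' hx hx' => simp only [map_add, LinearMap.add_apply, hx, hx']
    | single s a =>
      induction y using Finsupp.induction_linear with
      | zero => simp
      | add y y' hy hy' => simp only [map_add, hy, hy']
      | single t b =>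
        simp only [L, preNE_single, Finsupp.linearCombination_single, evalWord, map_smul,
          LinearMap.smul_apply, mul_smul, smul_comm a b]
  have Lof : ∀ x, L (preOf K V x) = f x := fun x => by simp [L, preOf, evalWord]
  have hL : relIdeal K V ≤ LinearMap.ker L := sInf_le
    { of_add := fun x y => by simp [Lof]
      of_smul := fun c x => by simp [Lof]
      ne_m := fun x y z => by simp [Lm, Lne, hA.ne_m]
      m_assoc := fun x y z => by simp [Lm, hA.m_assoc]
      ne_assoc := fun x y z => by simp [Lne, hA.ne_assoc]
      m_left := fun x y hy => by simp [Lm, LinearMap.mem_ker.1 hy]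
      m_right := fun x y hx => by simp [Lm, LinearMap.mem_ker.1 hx]
      ne_left := fun x y hy => by simp [Lne, LinearMap.mem_ker.1 hy]
      ne_right := fun x y hx => by simp [Lne, LinearMap.mem_ker.1 hx] }
  refine ⟨(relIdeal K V).liftQ L hL, ⟨fun x y => ?_, fun x y => ?_⟩, Lof⟩
  · obtain ⟨⟨x, rfl⟩, ⟨y, rfl⟩⟩ := mk_surjective x, mk_surjective y
    exact Lm x y
  · obtain ⟨⟨x, rfl⟩, ⟨y, rfl⟩⟩ := mk_surjective x, mk_surjective y
    exact Lne x y

theorem hom_ext {μ ν : A →ₗ[K] A →ₗ[K] A} {φ ψ : FreeNE K V →ₗ[K] A}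
    (hφ : IsNEAlgebraHom (m K V) (ne K V) μ ν φ) (hψ : IsNEAlgebraHom (m K V) (ne K V) μ ν ψ)
    (h : ∀ x, φ (ι K V x) = ψ (ι K V x)) : φ = ψ := by
  refine LinearMap.ext fun x => mem_of_generators (S := LinearMap.eqLocus φ ψ) h ?_ ?_ x
  · intro x hx y hy
    rw [LinearMap.mem_eqLocus] at *
    rw [hφ.map_m, hψ.map_m, hx, hy]
  · intro x hx y hy
    rw [LinearMap.mem_eqLocus] at *
    rw [hφ.map_ne, hψ.map_ne, hx, hy]

end Lift

variable (K V) in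
theorem ι_injective : Function.Injective (ι K V) := by
  -- `V` with zero products is an algebra, so that the identity of `V` extends to `FreeNE K V`.
  obtain ⟨φ, -, hφ⟩ := exists_lift (K := K) (V := V) (μ := 0) (ν := 0)
    ⟨by simp, by simp, by simp⟩ LinearMap.id
  exact Function.LeftInverse.injective hφ

variable (K V) in
theorem exists_comul {ε : K} (hε : ε * ε = ε) : ∃ Δ : FreeNE K V →ₗ[K] FreeNE K V ⊗[K] FreeNE K V,
    (∀ x, Δ (ι K V x) = 0) ∧ IsInfinitesimal 1 (m K V) Δ ∧ IsInfinitesimal ε (ne K V) Δ := by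
  have hF := isNEAlgebra K V
  obtain ⟨φ, hφ, hι⟩ := exists_lift (K := K) (V := V)
    (μ := infinitesimalProd 1 (m K V)) (ν := infinitesimalProd ε (ne K V))
    ⟨infinitesimalProd_assoc (one_mul ε) hF.ne_m, infinitesimalProd_assoc (one_mul 1) hF.m_assoc,
      infinitesimalProd_assoc hε hF.ne_assoc⟩ (LinearMap.inl K _ _ ∘ₗ ι K V)
  have h1 : LinearMap.fst K _ _ ∘ₗ φ = LinearMap.id :=
    hom_ext (μ := m K V) (ν := ne K V)
      ⟨fun x y => by simp [hφ.map_m, infinitesimalProd_apply],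
        fun x y => by simp [hφ.map_ne, infinitesimalProd_apply]⟩
      ⟨fun _ _ => rfl, fun _ _ => rfl⟩ (fun x => by simp [hι])
  have h1' : ∀ x, (φ x).1 = x := fun x => LinearMap.congr_fun h1 x
  refine ⟨LinearMap.snd K _ _ ∘ₗ φ, fun x => by simp [hι], fun x y => ?_, fun x y => ?_⟩
  · simp [hφ.map_m, infinitesimalProd_apply, h1']
  · simp [hφ.map_ne, infinitesimalProd_apply, h1']

theorem comul_map {A : Type w} [AddCommGroup A] [Module K A] {μ ν : A →ₗ[K] A →ₗ[K] A}
    {φ : FreeNE K V →ₗ[K] A} (hφ : IsNEAlgebraHom (m K V) (ne K V) μ ν φ)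
    {δ : FreeNE K V →ₗ[K] FreeNE K V ⊗[K] FreeNE K V} {Δ : A →ₗ[K] A ⊗[K] A}
    (hδ : ∀ x, δ (ι K V x) = 0) (hΔ : ∀ x, Δ (φ (ι K V x)) = 0) {ε η : K}
    (h1 : IsInfinitesimal ε (m K V) δ) (h2 : IsInfinitesimal η (ne K V) δ)
    (h1' : IsInfinitesimal ε μ Δ) (h2' : IsInfinitesimal η ν Δ) (x : FreeNE K V) :
    Δ (φ x) = TensorProduct.map φ φ (δ x) :=
  mem_of_generators (S := LinearMap.eqLocus (Δ ∘ₗ φ) (TensorProduct.map φ φ ∘ₗ δ))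
    (fun x => by simp [hδ, hΔ])
    (fun _ hx _ hy => h1'.map_comul h1 hφ.map_m hx hy)
    (fun _ hx _ hy => h2'.map_comul h2 hφ.map_ne hx hy) x

variable (K V) in
theorem exists_freeDoubleStructure : ∃ δ δne, IsFreeDoubleStructure K V δ δne := by
  obtain ⟨δ, hι, hm, hne⟩ := exists_comul K V (one_mul (1 : K))
  obtain ⟨δne, hι', hm', hne'⟩ := exists_comul K V (zero_mul (0 : K))
  -- All the coassociativity relations follow by induction on words.
  have key : ∀ (ε η : K) (a b : FreeNE K V →ₗ[K] FreeNE K V ⊗[K] FreeNE K V),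
      (∀ x, a (ι K V x) = 0) → (∀ x, b (ι K V x) = 0) → ε * η = η →
      IsInfinitesimal 1 (m K V) a → IsInfinitesimal ε (ne K V) a →
      IsInfinitesimal 1 (m K V) b → IsInfinitesimal η (ne K V) b →
      ∀ x, TensorProduct.assoc K _ _ _ (a.rTensor _ (b x)) = b.lTensor _ (a x) := by
    intro ε η a b ha hb hεη ham hane hbm hbne
    exact mem_of_generators (S := LinearMap.eqLocus
        ((TensorProduct.assoc K _ _ _).toLinearMap ∘ₗ a.rTensor _ ∘ₗ b) (b.lTensor _ ∘ₗ a))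
      (fun x => by simp [ha, hb])
      (fun _ hx _ hy => ham.coassoc (one_mul 1) hbm hx hy)
      (fun _ hx _ hy => hane.coassoc hεη hbne hx hy)
  refine ⟨δ, δne, ⟨isNEAlgebra K V, ⟨key 1 1 δ δ hι hι (one_mul 1) hm hne hm hne,
    key 0 0 δne δne hι' hι' (zero_mul 0) hm' hne' hm' hne',
    key 1 0 δ δne hι hι' (one_mul 0) hm hne hm' hne'⟩, fun x y => ?_, fun x y => ?_,
    fun x y => ?_, fun x y => ?_⟩, fun x => ⟨hι x, hι' x⟩⟩
  · rw [hm, one_smul, add_assoc]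
  · rw [hne, one_smul, add_assoc]
  · rw [hm', one_smul, add_assoc]
  · rw [hne', zero_smul, add_zero]

/-- An algebra morphism which sends the generators to primitive elements is a coalgebra morphism. -/
theorem _root_.IsFreeDoubleStructure.isCoalgebraHom {A : Type w} [AddCommGroup A] [Module K A]
    {μ ν : A →ₗ[K] A →ₗ[K] A} {Δ Δne : A →ₗ[K] A ⊗[K] A} (H : IsDoubleBialgebra μ ν Δ Δne)
    {δ δne : FreeNE K V →ₗ[K] FreeNE K V ⊗[K] FreeNE K V} (h : IsFreeDoubleStructure K V δ δne)
    {φ : FreeNE K V →ₗ[K] A} (hφ : IsNEAlgebraHom (m K V) (ne K V) μ ν φ)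
    (hΔ : ∀ x, Δ (φ (ι K V x)) = 0) (hΔne : ∀ x, Δne (φ (ι K V x)) = 0) :
    IsCoalgebraHom δ δne Δ Δne φ where
  comul := comul_map hφ (fun x => (h.2 x).1) hΔ h.1.comul_isInfinitesimal_m
    h.1.comul_isInfinitesimal_ne H.comul_isInfinitesimal_m H.comul_isInfinitesimal_ne
  comulNE := comul_map hφ (fun x => (h.2 x).2) hΔne h.1.comulNE_isInfinitesimal_m
    h.1.comulNE_isInfinitesimal_ne H.comulNE_isInfinitesimal_m H.comulNE_isInfinitesimal_ne

theorem _root_.IsFreeDoubleStructure.unique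
    {δ δne δ' δne' : FreeNE K V →ₗ[K] FreeNE K V ⊗[K] FreeNE K V}
    (h : IsFreeDoubleStructure K V δ δne) (h' : IsFreeDoubleStructure K V δ' δne') :
    δ = δ' ∧ δne = δne' := by
  have := h.isCoalgebraHom h'.1 (φ := LinearMap.id) ⟨fun _ _ => rfl, fun _ _ => rfl⟩
    (fun x => (h'.2 x).1) (fun x => (h'.2 x).2)
  refine ⟨LinearMap.ext fun x => ?_, LinearMap.ext fun x => ?_⟩
  · simpa using (this.comul x).symm
  · simpa using (this.comulNE x).symm

/-! ### Connectedness of the free algebra -/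

/-- The number of letters of a word. -/
def length {V : Type v} : NEWord V → ℕ
  | .of _ => 1
  | .m s t => length s + length t
  | .ne s t => length s + length t

theorem length_pos {V : Type v} (t : NEWord V) : 0 < length t := by
  induction t with
  | of => exact Nat.one_pos
  | m s t hs _ => exact Nat.add_pos_left hs _
  | ne s t hs _ => exact Nat.add_pos_left hs _

variable (K V) in
/-- The elements of degree `n` of the tensor square of the free algebra. -/
noncomputable def squareDeg (n : ℕ) : Submodule K (FreeNE K V ⊗[K] FreeNE K V) :=
  Submodule.span K {t | ∃ r s : NEWord V, length r + length s = n ∧ t = word r ⊗ₜ[K] word s}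

theorem map_mem_squareDeg {f : FreeNE K V ⊗[K] FreeNE K V →ₗ[K] FreeNE K V ⊗[K] FreeNE K V}
    {k n : ℕ}
    (h : ∀ r s : NEWord V, length r + length s = k → f (word r ⊗ₜ word s) ∈ squareDeg K V n)
    {u : FreeNE K V ⊗[K] FreeNE K V} (hu : u ∈ squareDeg K V k) : f u ∈ squareDeg K V n := by
  have : squareDeg K V k ≤ (squareDeg K V n).comap f := by
    refine Submodule.span_le.2 ?_
    rintro _ ⟨r, s, hrs, rfl⟩
    exact h r s hrs
  exact this hu

theorem comul_word_mem {δ : FreeNE K V →ₗ[K] FreeNE K V ⊗[K] FreeNE K V} {ε η : K}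
    (hδ : ∀ x, δ (ι K V x) = 0) (h1 : IsInfinitesimal ε (m K V) δ)
    (h2 : IsInfinitesimal η (ne K V) δ) (t : NEWord V) :
    δ (word t) ∈ squareDeg K V (length t) := by
  induction t with
  | of x => rw [word_of, hδ]; exact zero_mem _
  | m s t hs ht =>
    rw [← m_word, h1]
    refine add_mem (map_mem_squareDeg (fun p q hpq => ?_) ht)
      (Submodule.smul_mem _ _ (add_mem (map_mem_squareDeg (fun p q hpq => ?_) hs) ?_))
    · rw [LinearMap.rTensor_tmul, m_word]
      exact Submodule.subset_span ⟨_, _, by simp only [length]; omega, rfl⟩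
    · rw [LinearMap.lTensor_tmul, LinearMap.flip_apply, m_word]
      exact Submodule.subset_span ⟨_, _, by simp only [length]; omega, rfl⟩
    · exact Submodule.subset_span ⟨_, _, rfl, rfl⟩
  | ne s t hs ht =>
    rw [← ne_word, h2]
    refine add_mem (map_mem_squareDeg (fun p q hpq => ?_) ht)
      (Submodule.smul_mem _ _ (add_mem (map_mem_squareDeg (fun p q hpq => ?_) hs) ?_))
    · rw [LinearMap.rTensor_tmul, ne_word]
      exact Submodule.subset_span ⟨_, _, by simp only [length]; omega, rfl⟩
    · rw [LinearMap.lTensor_tmul, LinearMap.flip_apply, ne_word]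
      exact Submodule.subset_span ⟨_, _, by simp only [length]; omega, rfl⟩
    · exact Submodule.subset_span ⟨_, _, rfl, rfl⟩

theorem map_eq_zero_of_mem_squareDeg {X : Type*} [AddCommGroup X] [Module K X] {a b n : ℕ}
    {f g : FreeNE K V →ₗ[K] X} (hf : ∀ t : NEWord V, length t < a → f (word t) = 0)
    (hg : ∀ t : NEWord V, length t < b → g (word t) = 0) (hn : n < a + b)
    {u : FreeNE K V ⊗[K] FreeNE K V} (hu : u ∈ squareDeg K V n) :
    TensorProduct.map f g u = 0 := by
  have : squareDeg K V n ≤ LinearMap.ker (TensorProduct.map f g) := by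
    refine Submodule.span_le.2 ?_
    rintro _ ⟨r, s, hrs, rfl⟩
    rw [SetLike.mem_coe, LinearMap.mem_ker, TensorProduct.map_tmul]
    by_cases hr : length r < a
    · rw [hf r hr, TensorProduct.zero_tmul]
    · rw [hg s (by omega), TensorProduct.tmul_zero]
  exact this hu

theorem iteratedCoproduct_word_eq_zero {δ δne : FreeNE K V →ₗ[K] FreeNE K V ⊗[K] FreeNE K V}
    (h : IsFreeDoubleStructure K V δ δne) (c : CoShape) (t : NEWord V) (ht : length t < c.leaves) :
    iteratedCoproduct δ δne c (word t) = 0 := by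
  induction c generalizing t with
  | leaf => exact absurd ht (not_lt.2 (length_pos t))
  | node l r hl hr =>
    simp only [iteratedCoproduct, LinearMap.comp_apply]
    rw [map_eq_zero_of_mem_squareDeg hl hr ht (comul_word_mem (fun x => (h.2 x).1)
      h.1.comul_isInfinitesimal_m h.1.comul_isInfinitesimal_ne t), map_zero]
  | nodeNE l r hl hr =>
    simp only [iteratedCoproduct, LinearMap.comp_apply]
    rw [map_eq_zero_of_mem_squareDeg hl hr ht (comul_word_mem (fun x => (h.2 x).2)
      h.1.comulNE_isInfinitesimal_m h.1.comulNE_isInfinitesimal_ne t), map_zero]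

/-- The coproducts are homogeneous for the number of letters, so that an iterated coproduct with
more factors than a word has letters vanishes on it. -/
theorem _root_.IsFreeDoubleStructure.isConnectedCoalgebra
    {δ δne : FreeNE K V →ₗ[K] FreeNE K V ⊗[K] FreeNE K V} (h : IsFreeDoubleStructure K V δ δne) :
    IsConnectedCoalgebra δ δne := by
  have key : ∀ x : FreeNE K V, x ∈ ⨆ n, coradical δ δne n :=
    mem_of_word fun t => Submodule.mem_iSup_of_mem (length t)
      (mem_coradical.2 fun c hc => iteratedCoproduct_word_eq_zero h c t hc)
  intro a
  obtain ⟨N, hN⟩ := (Submodule.mem_iSup_of_directed _ coradical_mono.directed_le).1 (key a)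
  exact ⟨N, fun n hn t ht => mem_coradical.1 hN t (by omega)⟩

theorem _root_.IsFreeDoubleStructure.primitives_eq
    {δ δne : FreeNE K V →ₗ[K] FreeNE K V ⊗[K] FreeNE K V} (h : IsFreeDoubleStructure K V δ δne) :
    primitives δ δne = LinearMap.range (ι K V) := by
  obtain ⟨e, he⟩ := h.1.exists_kerProjection h.isConnectedCoalgebra
  obtain ⟨π, hπ⟩ := he.exists_primProjection h.1 h.isConnectedCoalgebra
  refine le_antisymm (fun x hx => ?_) ?_
  · have key : ∀ y : FreeNE K V, y ∈ (LinearMap.range (ι K V)).comap π :=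
      mem_of_generators
        (fun v => ⟨v, (hπ.eq_self _ (h.2 v).1 (h.2 v).2).symm⟩)
        (fun x _ y _ => by rw [Submodule.mem_comap, hπ.map_m]; exact zero_mem _)
        (fun x _ y _ => by rw [Submodule.mem_comap, hπ.map_ne]; exact zero_mem _)
    rw [← hπ.eq_self x hx.1 hx.2]
    exact key x
  · rintro _ ⟨v, rfl⟩
    exact h.2 v

end FreeNE

/-! ### Rigidity -/

section

variable {K : Type u} [Field K] {A : Type v} [AddCommGroup A] [Module K A]
  {m ne : A →ₗ[K] A →ₗ[K] A} {Δ Δne : A →ₗ[K] A ⊗[K] A}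

theorem IsCoalgebraHom.comp {B : Type*} [AddCommGroup B] [Module K B] {C : Type*}
    [AddCommGroup C] [Module K C] {δ δne : B →ₗ[K] B ⊗[K] B} {d dne : C →ₗ[K] C ⊗[K] C}
    {f : B →ₗ[K] A} {g : C →ₗ[K] B} (hf : IsCoalgebraHom δ δne Δ Δne f)
    (hg : IsCoalgebraHom d dne δ δne g) : IsCoalgebraHom d dne Δ Δne (f ∘ₗ g) where
  comul x := by
    rw [LinearMap.comp_apply, hf.comul, hg.comul, TensorProduct.map_comp, LinearMap.comp_apply]
  comulNE x := by
    rw [LinearMap.comp_apply, hf.comulNE, hg.comulNE, TensorProduct.map_comp, LinearMap.comp_apply]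

theorem IsCoalgebraHom.id : IsCoalgebraHom Δ Δne Δ Δne LinearMap.id where
  comul x := by simp
  comulNE x := by simp

theorem IsCoalgebraHom.iteratedCoproduct_map {B : Type*} [AddCommGroup B] [Module K B]
    {δ δne : B →ₗ[K] B ⊗[K] B} {f : B →ₗ[K] A} (hf : IsCoalgebraHom δ δne Δ Δne f)
    (t : CoShape) (x : B) : iteratedCoproduct Δ Δne t (f x) =
      TensorAlgebra.lift K (TensorAlgebra.ι K ∘ₗ f) (iteratedCoproduct δ δne t x) := by
  have key : ∀ l r : CoShape,
      (∀ x, iteratedCoproduct Δ Δne l (f x) =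
        TensorAlgebra.lift K (TensorAlgebra.ι K ∘ₗ f) (iteratedCoproduct δ δne l x)) →
      (∀ x, iteratedCoproduct Δ Δne r (f x) =
        TensorAlgebra.lift K (TensorAlgebra.ι K ∘ₗ f) (iteratedCoproduct δ δne r x)) →
      ∀ u : B ⊗[K] B, LinearMap.mul' K (TensorAlgebra K A)
          (TensorProduct.map (iteratedCoproduct Δ Δne l) (iteratedCoproduct Δ Δne r)
            (TensorProduct.map f f u)) =
        TensorAlgebra.lift K (TensorAlgebra.ι K ∘ₗ f) (LinearMap.mul' K (TensorAlgebra K B)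
          (TensorProduct.map (iteratedCoproduct δ δne l) (iteratedCoproduct δ δne r) u)) := by
    intro l r hl hr u
    induction u with
    | zero => simp
    | tmul p q => simp [hl, hr]
    | add s t hs ht => simp only [map_add, hs, ht]
  induction t generalizing x with
  | leaf => simp [iteratedCoproduct]
  | node l r hl hr =>
    simp only [iteratedCoproduct, LinearMap.comp_apply, hf.comul]
    exact key l r hl hr _
  | nodeNE l r hl hr =>
    simp only [iteratedCoproduct, LinearMap.comp_apply, hf.comulNE]
    exact key l r hl hr _

theorem IsConnectedCoalgebra.of_surjective {B : Type*} [AddCommGroup B] [Module K B]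
    {δ δne : B →ₗ[K] B ⊗[K] B} (hc : IsConnectedCoalgebra δ δne) {f : B →ₗ[K] A}
    (hf : IsCoalgebraHom δ δne Δ Δne f) (hs : Function.Surjective f) :
    IsConnectedCoalgebra Δ Δne := by
  intro a
  obtain ⟨b, rfl⟩ := hs a
  obtain ⟨N, hN⟩ := hc b
  exact ⟨N, fun n hn t ht => by rw [hf.iteratedCoproduct_map, hN n hn t ht, map_zero]⟩

theorem IsDoubleBialgebra.isFreeOnPrimitives (H : IsDoubleBialgebra m ne Δ Δne)
    (hc : IsConnectedCoalgebra Δ Δne) : IsFreeOnPrimitives m ne Δ Δne := by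
  obtain ⟨e, he⟩ := H.exists_kerProjection hc
  obtain ⟨π, hπ⟩ := he.exists_primProjection H hc
  obtain ⟨δ, δne, hF⟩ := FreeNE.exists_freeDoubleStructure K (primitives Δ Δne)
  have hFc := hF.isConnectedCoalgebra
  obtain ⟨e', he'⟩ := hF.1.exists_kerProjection hFc
  obtain ⟨π', hπ'⟩ := he'.exists_primProjection hF.1 hFc
  obtain ⟨φ, hφ, hι⟩ := FreeNE.exists_lift H.alg (primitives Δ Δne).subtype
  have hφc : IsCoalgebraHom δ δne Δ Δne φ := hF.isCoalgebraHom H hφ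
    (fun x => by rw [hι]; exact x.2.1) (fun x => by rw [hι]; exact x.2.2)
  -- The inverse of `φ` is the morphism to the cofree coalgebra `FreeNE K (primitives Δ Δne)`
  -- which lifts the projection `π`.
  let f : A →ₗ[K] FreeNE K (primitives Δ Δne) := FreeNE.ι K _ ∘ₗ
    π.codRestrict (primitives Δ Δne) fun x => ⟨hπ.comul x, hπ.comulNE x⟩
  obtain ⟨g, hg, hgf⟩ := hπ'.exists_lift he' hF.1 H.coalg hc f
    (fun x => (hF.2 _).1) (fun x => (hF.2 _).2)
  have hφπ : ∀ x, π (φ x) = φ (π' x) := fun x =>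
    FreeNE.mem_of_generators (S := LinearMap.eqLocus (π ∘ₗ φ) (φ ∘ₗ π'))
      (fun v => by
        simp only [LinearMap.mem_eqLocus, LinearMap.comp_apply]
        rw [hπ'.eq_self _ (hF.2 v).1 (hF.2 v).2, hι]
        exact hπ.eq_self _ v.2.1 v.2.2)
      (fun x _ y _ => by simp [hφ.map_m, hπ.map_m, hπ'.map_m])
      (fun x _ y _ => by simp [hφ.map_ne, hπ.map_ne, hπ'.map_ne]) x
  have hfφ : ∀ x, f (φ x) = π' x := fun x =>
    FreeNE.mem_of_generators (S := LinearMap.eqLocus (f ∘ₗ φ) π')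
      (fun v => by
        simp only [LinearMap.mem_eqLocus, LinearMap.comp_apply]
        rw [hπ'.eq_self _ (hF.2 v).1 (hF.2 v).2, hι]
        exact congrArg (FreeNE.ι K _) (Subtype.ext (hπ.eq_self _ v.2.1 v.2.2)))
      (fun x _ y _ => by
        simp only [LinearMap.mem_eqLocus, LinearMap.comp_apply, hφ.map_m, hπ'.map_m, f]
        rw [← map_zero (FreeNE.ι K (primitives Δ Δne))]
        exact congrArg (FreeNE.ι K _) (Subtype.ext (hπ.map_m _ _)))
      (fun x _ y _ => by
        simp only [LinearMap.mem_eqLocus, LinearMap.comp_apply, hφ.map_ne, hπ'.map_ne, f]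
        rw [← map_zero (FreeNE.ι K (primitives Δ Δne))]
        exact congrArg (FreeNE.ι K _) (Subtype.ext (hπ.map_ne _ _))) x
  have h1 : g ∘ₗ φ = LinearMap.id := hπ'.hom_ext hFc (hg.comp hφc) .id fun x => by
    simp [hgf, hfφ]
  have h2 : φ ∘ₗ g = LinearMap.id := hπ.hom_ext hc (hφc.comp hg) .id fun x => by
    simp only [LinearMap.comp_apply, hφπ, hgf, LinearMap.id_apply, f, hι]
    rfl
  exact ⟨δ, δne, hF, LinearEquiv.ofLinearMap φ g h2 h1, hφ, hφc, hι⟩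

theorem IsFreeOnPrimitives.isConnectedCoalgebra (h : IsFreeOnPrimitives m ne Δ Δne) :
    IsConnectedCoalgebra Δ Δne := by
  obtain ⟨δ, δne, hF, e, -, he, -⟩ := h
  exact hF.isConnectedCoalgebra.of_surjective he e.surjective

theorem IsDoubleBialgebra.isCofreeOnPrimitives (H : IsDoubleBialgebra m ne Δ Δne)
    (hc : IsConnectedCoalgebra Δ Δne) : IsCofreeOnPrimitives.{u, v, w} Δ Δne := by
  obtain ⟨e, he⟩ := H.exists_kerProjection hc
  obtain ⟨π, hπ⟩ := he.exists_primProjection H hc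
  refine ⟨hc, π.codRestrict (primitives Δ Δne) fun x => ⟨hπ.comul x, hπ.comulNE x⟩,
    fun x => Subtype.ext (hπ.eq_self _ x.2.1 x.2.2), fun C _ _ δ δne hδ hδc f => ?_⟩
  obtain ⟨g, hg, hgf⟩ := hπ.exists_lift he H hδ hδc ((primitives Δ Δne).subtype ∘ₗ f)
    (fun x => (f x).2.1) (fun x => (f x).2.2)
  refine ⟨g, ⟨hg, LinearMap.ext fun x => Subtype.ext (hgf x)⟩, fun g' ⟨hg', hgf'⟩ => ?_⟩
  exact hπ.hom_ext hδc hg' hg fun x =>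
    (congrArg Subtype.val (LinearMap.congr_fun hgf' x)).trans (hgf x).symm

end

theorem theorem45 (K : Type u) [Field K] :
    -- the rigidity theorem
    (∀ (A : Type v) [AddCommGroup A] [Module K A]
      (m ne : A →ₗ[K] A →ₗ[K] A) (Δ Δne : A →ₗ[K] A ⊗[K] A),
      IsDoubleBialgebra m ne Δ Δne → IsConnectedCoalgebra Δ Δne →
        IsFreeOnPrimitives m ne Δ Δne) ∧
    -- the triple `((P_↗)^op, P_↗, VECT)` is good:
    -- free algebras are connected bialgebras whose primitive elements are the generators,
    (∀ (V : Type v) [AddCommGroup V] [Module K V],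
      (∃! p : (FreeNE K V →ₗ[K] FreeNE K V ⊗[K] FreeNE K V) ×
          (FreeNE K V →ₗ[K] FreeNE K V ⊗[K] FreeNE K V), IsFreeDoubleStructure K V p.1 p.2) ∧
      Function.Injective (FreeNE.ι K V) ∧
      ∀ δ δne : FreeNE K V →ₗ[K] FreeNE K V ⊗[K] FreeNE K V, IsFreeDoubleStructure K V δ δne →
        IsConnectedCoalgebra δ δne ∧ primitives δ δne = LinearMap.range (FreeNE.ι K V)) ∧
    -- and connectedness, freeness and cofreeness over the primitive elements are equivalent
    (∀ (A : Type v) [AddCommGroup A] [Module K A]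
      (m ne : A →ₗ[K] A →ₗ[K] A) (Δ Δne : A →ₗ[K] A ⊗[K] A),
      IsDoubleBialgebra m ne Δ Δne →
        [IsConnectedCoalgebra Δ Δne, IsFreeOnPrimitives m ne Δ Δne,
          IsCofreeOnPrimitives.{u, v, w} Δ Δne].TFAE) := by
  refine ⟨fun A _ _ m ne Δ Δne H hc => H.isFreeOnPrimitives hc, fun V _ _ => ⟨?_, ?_, ?_⟩,
    fun A _ _ m ne Δ Δne H => ?_⟩
  · obtain ⟨δ, δne, h⟩ := FreeNE.exists_freeDoubleStructure K V
    exact ⟨(δ, δne), h, fun p hp => Prod.ext (hp.unique h).1 (hp.unique h).2⟩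
  · exact FreeNE.ι_injective K V
  · exact fun δ δne h => ⟨h.isConnectedCoalgebra, h.primitives_eq⟩
  · tfae_have 1 → 2 := H.isFreeOnPrimitives
    tfae_have 2 → 1 := fun h => h.isConnectedCoalgebra
    tfae_have 1 → 3 := H.isCofreeOnPrimitives
    tfae_have 3 → 1 := fun h => h.1
    tfae_finish
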